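/- Let $n\ge 1$. A convex body in $\mathbb R^n$ is a compact convex set with non-empty interior; it is unconditional if with every point $(x_1,\dots,x_n)$ it contains all the points $(\pm x_1,\dots,\pm x_n)$. For a convex body $K=-K$ write $K^\circ=\{y\in\mathbb R^n:\langle x,y\rangle\le 1\text{ for all }x\in K\}$ and $\mathcal P(K)=|K|\,|K^\circ|$, where $|\cdot|$ is Lebesgue measure, and let $B_\infty^n=[-1,1]^n$. For convex bodies $K=-K$, $L=-L$ put $d_{BM}(K,L)=\inf\{d\ge1: L\subset TK\subset dL\text{ for some }T\in GL(n)\}$. A Hanner polytope is a set obtained recursively as follows: every segment $[-v,v]$ with $v\ne0$ is a Hanner polytope, and if $A$, $B$ are Hanner polytopes whose linear spans intersect only in $0$, then the $\ell_1$-sum $\mathrm{conv}(A\cup B)$ and the $\ell_\infty$-sum $A+B$ are Hanner polytopes. There are constants $\varepsilon_n>0$ and $c(n)>0$, depending only on $n$, such that the following holds for all $0<\varepsilon\le\varepsilon_n$: if $K\subset\mathbb R^n$ is an unconditional convex body with $|\mathcal P(K)-\mathcal P(B_\infty^n)|\le\varepsilon$, then there is an $n$-dimensional Hanner polytope $H\subset\mathbb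 R^n$ with $$d_{BM}(K,H)\le 1+c(n)\,\varepsilon .$$ -/

import Mathlib

open MeasureTheory

open scoped Pointwise

/-- A convex body in `ℝⁿ`: a compact convex set with non-empty interior. -/
def IsConvexBody {n : ℕ} (K : Set (EuclideanSpace ℝ (Fin n))) : Prop :=
  Convex ℝ K ∧ IsCompact K ∧ (interior K).Nonempty

/-- `K` is unconditional: with `x` it contains every point `(±x₁, …, ±xₙ)`. -/
def IsUnconditional {n : ℕ} (K : Set (EuclideanSpace ℝ (Fin n))) : Prop :=
  ∀ x ∈ K, ∀ y : EuclideanSpace ℝ (Fin n), (∀ i, y i = x i ∨ y i = -x i) → y ∈ K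

/-- The polar `K° = {y : ⟨x, y⟩ ≤ 1 for all x ∈ K}`. -/
def polarBody {n : ℕ} (K : Set (EuclideanSpace ℝ (Fin n))) :
    Set (EuclideanSpace ℝ (Fin n)) :=
  {y | ∀ x ∈ K, inner ℝ x y ≤ 1}

/-- The volume product `P(K) = |K| |K°|`. -/
noncomputable def volumeProduct {n : ℕ} (K : Set (EuclideanSpace ℝ (Fin n))) : ℝ :=
  volume.real K * volume.real (polarBody K)

/-- The cube `B_∞ⁿ = [-1, 1]ⁿ`. -/
def unitCube (n : ℕ) : Set (EuclideanSpace ℝ (Fin n)) :=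
  {x | ∀ i, |x i| ≤ 1}

/-- The Banach–Mazur distance
`inf {d ≥ 1 : L ⊆ T K ⊆ d L for some T ∈ GL(n)}`. It is used only for symmetric convex bodies,
for which the set of admissible `d` is non-empty. -/
noncomputable def banachMazurDist {n : ℕ} (K L : Set (EuclideanSpace ℝ (Fin n))) : ℝ :=
  sInf {d : ℝ | 1 ≤ d ∧
    ∃ T : EuclideanSpace ℝ (Fin n) ≃ₗ[ℝ] EuclideanSpace ℝ (Fin n),
      L ⊆ T '' K ∧ T '' K ⊆ d • L}

/-- Hanner polytopes, of any dimension `≥ 1`, inside a real vector space: the one-dimensional ones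
are the segments `[-v, v]` with `v ≠ 0`; the others are the `ℓ₁`-sums `conv (A ∪ B)` and the
`ℓ_∞`-sums `A + B` of two Hanner polytopes that lie in linearly independent subspaces. -/
inductive IsHanner {E : Type*} [AddCommGroup E] [Module ℝ E] : Set E → Prop
  | interval (v : E) (hv : v ≠ 0) : IsHanner (segment ℝ (-v) v)
  | l1Sum (A B : Set E) (hA : IsHanner A) (hB : IsHanner B)
      (hAB : Disjoint (Submodule.span ℝ A) (Submodule.span ℝ B)) :
      IsHanner (convexHull ℝ (A ∪ B))
  | linftySum (A B : Set E) (hA : IsHanner A) (hB : IsHanner B)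
      (hAB : Disjoint (Submodule.span ℝ A) (Submodule.span ℝ B)) :
      IsHanner (A + B)

/-- An `n`-dimensional Hanner polytope in `ℝⁿ`, i.e. one that is a convex body of `ℝⁿ`
(convexity, compactness and symmetry hold for every set satisfying `IsHanner`). -/
def IsHannerPolytope {n : ℕ} (H : Set (EuclideanSpace ℝ (Fin n))) : Prop :=
  IsHanner H ∧ (interior H).Nonempty

/-!
An unconditional body is determined by its positive corner, and after rescaling the axes the corner
`K` and its polar `L` lie between the cross-polytope and the cube (`IsPolarPair`). Write `|K|` for
the volume of the corner (`cornerVol`) and `Kᵢ` for its section by the `i`-th coordinate hyperplane.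

Meyer's inequality `∑ xᵢ |Kᵢ| ≤ n |K|` for `x ∈ K` (`IsPolarPair.sum_facets_le`) holds because the
pyramids over the `Kᵢ` with apex `x` do not overlap. It says that the vector `(|Kᵢ| / (n |K|))`
lies in `L`; pairing it with its counterpart in `K` gives Saint-Raymond's inequality
`n! |K| |L| ≥ 1` by induction, and shows that all coordinate sections of an almost extremal pair
are almost extremal too. All of this is linear in the deficit, as is everything below.

The main estimate (`IsPolarPair.cube_estimate`) concerns an almost extremal `K` whose facets `Kᵢ` are
almost cubes. Here `K` contains a diagonal point `(t, …, t)` with `t` almost equal to `|K|`, so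
Meyer's pyramids with this apex almost exhaust `K`. A point of `K` beyond the hyperplane spanned by
the apex and a codimension-two face of the cube in a coordinate hyperplane would add a slab of
comparable volume. In the plane, this bound on `K` exhibits a point of `L`, and the same bound on
`L` at that point forces `K` or `L` to be almost the square
(`IsPolarPair.square_or_triangle`). In higher dimensions it forces `t` to be almost `1`, whence `K`
is almost the cube as soon as its planar sections are almost squares
(`IsPolarPair.exists_const_mem`).

The planar sections therefore define a graph `G` on the coordinates, two coordinates being adjacent
if `L` contains almost the square over them. By the preceding step `K` almost contains the
indicators of independent sets and `L` those of cliques. An induced path on four vertices would give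
a section with `|K|` and `|L|` both almost at least `5/24`, by Meyer's inequality again, while
`25/576 > 1/4!` (`IsPolarPair.not_isInducedPath`). So `G` arises from points by disjoint unions and
joins (`splitsInto_or_compl`). These operations turn the unconditional hull of the indicators of
independent sets into `ℓ_∞`-sums and `ℓ₁`-sums, so that it is a Hanner polytope, and they preserve the
fact that it is cut out by the clique inequalities (`isHanner_and_cliqueDetermined`). The body is
thus squeezed between two multiples of this Hanner polytope (`sandwich`).
-/

/-! ### Polar pairs of convex corners -/

/-- `K` and `L` are convex corners in the positive orthant of `ℝⁿ`, polar to each other inside the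
orthant, and both contain the standard basis vectors. They stand for the positive parts of an
unconditional convex body and its polar, rescaled so that both are squeezed between the
cross-polytope and the cube. Convexity, closedness and monotonicity follow from the two
descriptions as intersections of half-spaces. -/
structure IsPolarPair {n : ℕ} (K L : Set (Fin n → ℝ)) : Prop where
  mem_left : ∀ x, x ∈ K ↔ 0 ≤ x ∧ ∀ y ∈ L, x ⬝ᵥ y ≤ 1
  mem_right : ∀ y, y ∈ L ↔ 0 ≤ y ∧ ∀ x ∈ K, x ⬝ᵥ y ≤ 1
  single_left : ∀ i, Pi.single i 1 ∈ K
  single_right : ∀ i, Pi.single i 1 ∈ L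

/-- The projection of `K ⊆ ℝⁿ` to the coordinates `f 0, …, f (k - 1)`. For a convex corner and an
injective `f` it is also the coordinate section. -/
def coordProj {k n : ℕ} (f : Fin k → Fin n) (K : Set (Fin n → ℝ)) : Set (Fin k → ℝ) :=
  (fun x => x ∘ f) '' K

/-- The open positive orthant. -/
def openOrthant (n : ℕ) : Set (Fin n → ℝ) := {x | ∀ i, 0 < x i}

/-- The volume of the part of `K` in the open positive orthant. Using the open orthant makes the
pieces in the pyramid decomposition disjoint on the nose. -/
noncomputable def cornerVol {n : ℕ} (K : Set (Fin n → ℝ)) : ℝ :=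
  volume.real (K ∩ openOrthant n)

theorem measurableSet_openOrthant (n : ℕ) : MeasurableSet (openOrthant n) := by
  unfold openOrthant
  measurability

theorem coordProj_coordProj {j k n : ℕ} (f : Fin k → Fin n) (g : Fin j → Fin k)
    (K : Set (Fin n → ℝ)) : coordProj g (coordProj f K) = coordProj (f ∘ g) K := by
  unfold coordProj
  rw [Set.image_image]
  rfl

namespace IsPolarPair

variable {n k m : ℕ} {K L : Set (Fin n → ℝ)}

theorem symm (h : IsPolarPair K L) : IsPolarPair L K where
  mem_left x := by
    rw [h.mem_right]
    simp only [dotProduct_comm x]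
  mem_right y := by
    rw [h.mem_left]
    simp only [dotProduct_comm _ y]
  single_left := h.single_right
  single_right := h.single_left

theorem nonneg (h : IsPolarPair K L) {x : Fin n → ℝ} (hx : x ∈ K) (i : Fin n) : 0 ≤ x i :=
  ((h.mem_left x).1 hx).1 i

theorem dot_le (h : IsPolarPair K L) {x y : Fin n → ℝ} (hx : x ∈ K) (hy : y ∈ L) :
    x ⬝ᵥ y ≤ 1 :=
  ((h.mem_left x).1 hx).2 y hy

theorem mono (h : IsPolarPair K L) {x y : Fin n → ℝ} (hx : x ∈ K) (hy : ∀ i, 0 ≤ y i)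
    (hyx : ∀ i, y i ≤ x i) : y ∈ K :=
  (h.mem_left y).2 ⟨hy, fun _ hz =>
    (dotProduct_le_dotProduct_of_nonneg_right hyx fun i => h.symm.nonneg hz i).trans
      (h.dot_le hx hz)⟩

theorem zero_mem (h : IsPolarPair K L) : (0 : Fin n → ℝ) ∈ K :=
  (h.mem_left 0).2 ⟨le_rfl, by simp⟩

theorem le_one (h : IsPolarPair K L) {x : Fin n → ℝ} (hx : x ∈ K) (i : Fin n) : x i ≤ 1 := by
  simpa using h.dot_le hx (h.single_right i)

theorem comb_mem (h : IsPolarPair K L) {x y z : Fin n → ℝ} (hx : x ∈ K) (hy : y ∈ K) (hz : z ∈ K)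
    {a b c : ℝ} (ha : 0 ≤ a) (hb : 0 ≤ b) (hc : 0 ≤ c) (habc : a + b + c ≤ 1) :
    a • x + b • y + c • z ∈ K := by
  refine (h.mem_left _).2 ⟨fun i => ?_, fun w hw => ?_⟩
  · have := h.nonneg hx i
    have := h.nonneg hy i
    have := h.nonneg hz i
    simp only [Pi.zero_apply, Pi.add_apply, Pi.smul_apply, smul_eq_mul]
    positivity
  · simp only [add_dotProduct, smul_dotProduct, smul_eq_mul]
    have := mul_le_mul_of_nonneg_left (h.dot_le hx hw) ha
    have := mul_le_mul_of_nonneg_left (h.dot_le hy hw) hb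
    have := mul_le_mul_of_nonneg_left (h.dot_le hz hw) hc
    linarith

theorem isClosed (h : IsPolarPair K L) : IsClosed K := by
  have : K = {x | 0 ≤ x} ∩ ⋂ y ∈ L, {x | x ⬝ᵥ y ≤ 1} := by
    ext x
    simp [h.mem_left x]
  rw [this]
  refine (isClosed_le continuous_const continuous_id).inter
    (isClosed_biInter fun y _ => isClosed_le ?_ continuous_const)
  unfold dotProduct
  fun_prop

theorem measurableSet (h : IsPolarPair K L) : MeasurableSet (K ∩ openOrthant n) :=
  h.isClosed.measurableSet.inter (measurableSet_openOrthant n)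

theorem subset_Icc (h : IsPolarPair K L) : K ∩ openOrthant n ⊆ Set.Icc 0 1 :=
  fun _ hx => ⟨h.nonneg hx.1, h.le_one hx.1⟩

theorem volume_ne_top (h : IsPolarPair K L) : volume (K ∩ openOrthant n) ≠ ⊤ :=
  ((measure_mono h.subset_Icc).trans_lt isCompact_Icc.measure_lt_top).ne

theorem cornerVol_nonneg (K : Set (Fin n → ℝ)) : 0 ≤ cornerVol K := measureReal_nonneg

theorem cornerVol_le_one (h : IsPolarPair K L) : cornerVol K ≤ 1 := by
  have h1 : volume.real (Set.Icc (0 : Fin n → ℝ) 1) = 1 := by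
    simp [Measure.real, Real.volume_Icc_pi]
  rw [← h1]
  exact measureReal_mono h.subset_Icc isCompact_Icc.measure_lt_top.ne

theorem pow_le_cornerVol (h : IsPolarPair K L) {a : ℝ} (ha : 0 ≤ a) (hK : (fun _ => a) ∈ K) :
    a ^ n ≤ cornerVol K := by
  have h1 : volume.real (Set.univ.pi fun _ : Fin n => Set.Ioo (0 : ℝ) a) = a ^ n := by
    simp [Measure.real, Real.volume_pi_Ioo, ENNReal.toReal_ofReal ha]
  rw [← h1]
  refine measureReal_mono (fun x hx => ⟨h.mono hK (fun i => ?_) fun i => ?_, fun i => ?_⟩)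
    h.volume_ne_top
  · exact (hx i trivial).1.le
  · exact (hx i trivial).2.le
  · exact (hx i trivial).1

/-- Extending a point of a coordinate projection by zeros stays inside the corner, because corners
are monotone. -/
theorem extend_mem (h : IsPolarPair K L) {f : Fin k → Fin n} {w : Fin k → ℝ}
    (hw : w ∈ coordProj f K) : ∃ x ∈ K, x ∘ f = w ∧ ∀ i, i ∉ Set.range f → x i = 0 := by
  obtain ⟨x, hx, rfl⟩ := hw
  classical
  refine ⟨fun i => if i ∈ Set.range f then x i else 0, h.mono hx (fun i => ?_)
    (fun i => ?_), ?_, ?_⟩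
  · split_ifs
    exacts [h.nonneg hx i, le_rfl]
  · split_ifs
    exacts [le_rfl, h.nonneg hx i]
  · ext j
    simp
  · intro i hi
    simp [hi]

theorem dot_comp_le (h : IsPolarPair K L) {f : Fin k → Fin n} (hf : f.Injective) {x y : Fin n → ℝ}
    (hx : x ∈ K) (hy : y ∈ L) : (x ∘ f) ⬝ᵥ (y ∘ f) ≤ 1 := by
  refine le_trans ?_ (h.dot_le hx hy)
  have h1 : (x ∘ f) ⬝ᵥ (y ∘ f) = ∑ i ∈ Finset.univ.map ⟨f, hf⟩, x i * y i := by
    simp [dotProduct]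
  rw [h1]
  exact Finset.sum_le_sum_of_subset_of_nonneg (Finset.subset_univ _) fun i _ _ =>
    mul_nonneg (h.nonneg hx i) (h.symm.nonneg hy i)

theorem mem_coordProj_of_dot_le (h : IsPolarPair K L) {f : Fin k → Fin n} (hf : f.Injective)
    {w : Fin k → ℝ} (hw : 0 ≤ w) (hwL : ∀ y ∈ coordProj f L, w ⬝ᵥ y ≤ 1) :
    w ∈ coordProj f K := by
  refine ⟨∑ j, Pi.single (f j) (w j), (h.mem_left _).2 ⟨?_, fun y hy => ?_⟩, ?_⟩
  · exact Finset.sum_nonneg fun j _ => Pi.single_nonneg.2 (hw j)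
  · rw [sum_dotProduct]
    simp only [single_dotProduct]
    exact hwL _ ⟨y, hy, rfl⟩
  · ext j
    simp [Finset.sum_apply, Pi.single_apply, hf.eq_iff]

/-- Polarity commutes with passing to coordinate sections. -/
theorem proj (h : IsPolarPair K L) {f : Fin k → Fin n} (hf : f.Injective) :
    IsPolarPair (coordProj f K) (coordProj f L) where
  mem_left w := by
    refine ⟨?_, fun hw => h.mem_coordProj_of_dot_le hf hw.1 hw.2⟩
    rintro ⟨x, hx, rfl⟩
    refine ⟨fun j => h.nonneg hx (f j), ?_⟩
    rintro _ ⟨y, hy, rfl⟩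
    exact h.dot_comp_le hf hx hy
  mem_right w := by
    refine ⟨?_, fun hw => h.symm.mem_coordProj_of_dot_le hf hw.1 fun y hy => ?_⟩
    · rintro ⟨y, hy, rfl⟩
      refine ⟨fun j => h.symm.nonneg hy (f j), ?_⟩
      rintro _ ⟨x, hx, rfl⟩
      exact h.dot_comp_le hf hx hy
    · rw [dotProduct_comm]
      exact hw.2 y hy
  single_left j := ⟨_, h.single_left (f j), by ext i; simp [Pi.single_apply, hf.eq_iff]⟩
  single_right j := ⟨_, h.single_right (f j), by ext i; simp [Pi.single_apply, hf.eq_iff]⟩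

end IsPolarPair

/-! ### The pyramid decomposition -/

theorem volume_eq_lintegral_slice {m : ℕ} (i : Fin (m + 1)) {S : Set (Fin (m + 1) → ℝ)}
    (hS : MeasurableSet S) :
    volume S = ∫⁻ t : ℝ, volume {w : Fin m → ℝ | i.insertNth t w ∈ S} := by
  have hp := (volume_preserving_piFinSuccAbove (fun _ : Fin (m + 1) => ℝ) i).symm
  rw [← hp.measure_preimage hS.nullMeasurableSet]
  rw [Measure.volume_eq_prod, Measure.prod_apply (hp.measurable hS)]
  rfl

/-- The pyramid with apex `x` over the set `B` in the hyperplane `y i = 0`, without its base and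
apex: the points `r x + (1 - r) w` with `w ∈ B` and `0 < r < 1`, where `r = y i / x i`. -/
def pyramid {m : ℕ} (i : Fin (m + 1)) (x : Fin (m + 1) → ℝ) (B : Set (Fin m → ℝ)) :
    Set (Fin (m + 1) → ℝ) :=
  {y | (0 < y i ∧ y i < x i) ∧
    (1 - y i / x i)⁻¹ • (i.removeNth y - (y i / x i) • i.removeNth x) ∈ B}

theorem measurableSet_pyramid {m : ℕ} (i : Fin (m + 1)) (x : Fin (m + 1) → ℝ)
    {B : Set (Fin m → ℝ)} (hB : MeasurableSet B) : MeasurableSet (pyramid i x B) := by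
  unfold pyramid
  refine MeasurableSet.inter ?_ (measurableSet_preimage ?_ hB)
  · exact (measurableSet_lt measurable_const (measurable_pi_apply i)).inter
      (measurableSet_lt (measurable_pi_apply i) measurable_const)
  · unfold Fin.removeNth
    fun_prop

theorem volume_pyramid {m : ℕ} (i : Fin (m + 1)) {x : Fin (m + 1) → ℝ} (hx : 0 ≤ x i)
    {B : Set (Fin m → ℝ)} (hB : MeasurableSet B) :
    volume (pyramid i x B) = ENNReal.ofReal (x i / (m + 1)) * volume B := by
  rcases hx.eq_or_lt with hx0 | hx0
  · have : pyramid i x B = ∅ := by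
      ext y
      simp only [pyramid, ← hx0, Set.mem_ofPred_eq, Set.mem_empty_iff_false, iff_false]
      rintro ⟨⟨h1, h2⟩, -⟩
      exact lt_asymm h1 h2
    simp [this, ← hx0]
  rw [volume_eq_lintegral_slice i (measurableSet_pyramid i x hB)]
  have hslice : ∀ t : ℝ, volume {w : Fin m → ℝ | i.insertNth t w ∈ pyramid i x B}
      = (Set.Ioo 0 (x i)).indicator
        (fun t => ENNReal.ofReal ((1 - t / x i) ^ m) * volume B) t := by
    intro t
    by_cases ht : t ∈ Set.Ioo 0 (x i)
    · have hr : 0 < 1 - t / x i := by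
        rw [sub_pos, div_lt_one hx0]
        exact ht.2
      rw [Set.indicator_of_mem ht]
      have h1 : {w : Fin m → ℝ | i.insertNth t w ∈ pyramid i x B}
          = (fun w => w + (-((t / x i) • i.removeNth x))) ⁻¹'
            ((fun w => (1 - t / x i)⁻¹ • w) ⁻¹' B) := by
        ext w
        simp [pyramid, ht.1, ht.2, sub_eq_add_neg]
      rw [h1, measure_preimage_add_right, Measure.addHaar_preimage_smul _ (inv_ne_zero hr.ne')]
      simp [abs_of_pos hr]
    · rw [Set.indicator_of_notMem ht]
      have h1 : {w : Fin m → ℝ | i.insertNth t w ∈ pyramid i x B} = ∅ := by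
        ext w
        simp only [pyramid, Set.mem_ofPred_eq, Fin.insertNth_apply_same, Set.mem_empty_iff_false,
          iff_false]
        exact fun h => ht h.1
      rw [h1, measure_empty]
  simp_rw [hslice]
  rw [lintegral_indicator measurableSet_Ioo, lintegral_mul_const _ (by fun_prop)]
  congr 1
  have hint : ∫ t in (0 : ℝ)..x i, (1 - t / x i) ^ m = x i / (m + 1) := by
    have := intervalIntegral.integral_comp_sub_div (a := 0) (b := x i) (fun u : ℝ => u ^ m)
      hx0.ne' 1
    rw [this]
    simp [hx0.ne', div_eq_mul_inv]
  rw [← hint, intervalIntegral.integral_of_le hx, integral_Ioc_eq_integral_Ioo,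
    ofReal_integral_eq_lintegral_ofReal]
  · exact (Continuous.integrableOn_Icc (by fun_prop)).mono_set Set.Ioo_subset_Icc_self
  · filter_upwards [ae_restrict_mem measurableSet_Ioo] with t ht
    have : t / x i ≤ 1 := (div_le_one hx0).2 ht.2.le
    exact pow_nonneg (by linarith) m

namespace IsPolarPair

section Pyramids

variable {m : ℕ} {K L : Set (Fin (m + 1) → ℝ)}

/-- The section of `K` by the coordinate hyperplane `y i = 0`, restricted to the open orthant. -/
abbrev facet (i : Fin (m + 1)) (K : Set (Fin (m + 1) → ℝ)) : Set (Fin m → ℝ) :=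
  coordProj i.succAbove K ∩ openOrthant m

theorem insertNth_mem (h : IsPolarPair K L) {i : Fin (m + 1)} {w : Fin m → ℝ}
    (hw : w ∈ coordProj i.succAbove K) : i.insertNth 0 w ∈ K := by
  obtain ⟨x, hx, rfl, hx0⟩ := h.extend_mem hw
  convert hx
  refine (Fin.insertNth_eq_iff).2 ⟨(hx0 i ?_).symm, rfl⟩
  simp

theorem lt_of_mem_pyramid {i : Fin (m + 1)} {x y : Fin (m + 1) → ℝ}
    (hy : y ∈ pyramid i x (facet i K)) (l : Fin m) :
    y i / x i * x (i.succAbove l) < y (i.succAbove l) := by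
  have hr : 0 < 1 - y i / x i := by
    rw [sub_pos, div_lt_one (hy.1.1.trans hy.1.2)]
    exact hy.1.2
  have h1 := hy.2.2 l
  simp only [Pi.smul_apply, smul_eq_mul, Pi.sub_apply, Fin.removeNth_apply] at h1
  have := (mul_pos_iff_of_pos_left (inv_pos.2 hr)).1 h1
  linarith

theorem pyramid_subset (h : IsPolarPair K L) (i : Fin (m + 1)) {x : Fin (m + 1) → ℝ} (hx : x ∈ K) :
    pyramid i x (facet i K) ⊆ K ∩ openOrthant (m + 1) := by
  intro y hy
  have hxi : 0 < x i := hy.1.1.trans hy.1.2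
  have hr0 : 0 < y i / x i := div_pos hy.1.1 hxi
  have hr : 0 < 1 - y i / x i := by
    rw [sub_pos, div_lt_one hxi]
    exact hy.1.2
  constructor
  · have h1 := h.comb_mem hx (h.insertNth_mem hy.2.1) h.zero_mem hr0.le hr.le le_rfl (by linarith)
    convert h1
    ext j
    rcases Fin.eq_self_or_eq_succAbove i j with rfl | ⟨l, rfl⟩
    · simp [hxi.ne']
    · simp only [smul_zero, add_zero, Pi.add_apply, Pi.smul_apply, smul_eq_mul,
        Fin.insertNth_apply_succAbove, Pi.sub_apply, Fin.removeNth_apply, Pi.zero_apply]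
      rw [mul_inv_cancel_left₀ hr.ne']
      ring
  · intro j
    rcases Fin.eq_self_or_eq_succAbove i j with rfl | ⟨l, rfl⟩
    · exact hy.1.1
    · exact (mul_nonneg hr0.le (h.nonneg hx _)).trans_lt (lt_of_mem_pyramid hy l)

theorem pyramid_disjoint {x : Fin (m + 1) → ℝ} :
    Pairwise fun i j => Disjoint (pyramid i x (facet i K)) (pyramid j x (facet j K)) := by
  intro i j hij
  refine Set.disjoint_left.2 fun y hi hj => ?_
  have hxi : 0 < x i := hi.1.1.trans hi.1.2
  have hxj : 0 < x j := hj.1.1.trans hj.1.2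
  obtain ⟨l, rfl⟩ := Fin.exists_succAbove_eq hij
  obtain ⟨l', hl'⟩ := Fin.exists_succAbove_eq hij.symm
  have h1 := lt_of_mem_pyramid hj l
  have h2 := lt_of_mem_pyramid hi l'
  rw [hl', ← lt_div_iff₀ hxj] at h2
  rw [← lt_div_iff₀ hxi] at h1
  exact lt_asymm h1 h2

/-- Meyer's inequality with a remainder: the pyramids with apex `x` over the coordinate sections
of `K` are disjoint subsets of `K`, and so is any `E` that avoids them. -/
theorem sum_pyramids_add_le (h : IsPolarPair K L) {x : Fin (m + 1) → ℝ} (hx : x ∈ K)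
    {E : Set (Fin (m + 1) → ℝ)} (hE : MeasurableSet E) (hEK : E ⊆ K ∩ openOrthant (m + 1))
    (hdisj : ∀ i, Disjoint (pyramid i x (facet i K)) E) :
    ∑ i, x i / (m + 1) * cornerVol (coordProj i.succAbove K) + volume.real E ≤ cornerVol K := by
  have hB : ∀ i : Fin (m + 1), MeasurableSet (facet i K) := fun i =>
    (h.proj i.succAbove_right_injective).measurableSet
  have hvol : ∀ i, volume.real (pyramid i x (facet i K))
      = x i / (m + 1) * cornerVol (coordProj i.succAbove K) := by
    intro i
    have : 0 ≤ x i / (m + 1) := div_nonneg (h.nonneg hx i) (by positivity)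
    rw [Measure.real, volume_pyramid i (h.nonneg hx i) (hB i), ENNReal.toReal_mul,
      ENNReal.toReal_ofReal this]
    rfl
  have hfin : ∀ i, volume (pyramid i x (facet i K)) ≠ ⊤ := fun i =>
    measure_ne_top_of_subset (h.pyramid_subset i hx) h.volume_ne_top
  have hEfin : volume E ≠ ⊤ := measure_ne_top_of_subset hEK h.volume_ne_top
  simp_rw [← hvol]
  have h1 := measureReal_biUnion_finset (μ := volume) (s := Finset.univ)
    (f := fun i => pyramid i x (facet i K)) (fun i _ j _ hij => pyramid_disjoint hij)
    (fun i _ => measurableSet_pyramid i x (hB i)) (fun i _ => hfin i)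
  simp only [Finset.mem_univ, Set.iUnion_true] at h1
  have hUfin : volume (⋃ i, pyramid i x (facet i K)) ≠ ⊤ :=
    measure_ne_top_of_subset (Set.iUnion_subset fun i => h.pyramid_subset i hx) h.volume_ne_top
  rw [← h1, ← measureReal_union (Set.disjoint_iUnion_left.2 hdisj) hE hUfin hEfin]
  exact measureReal_mono
    (Set.union_subset (Set.iUnion_subset fun i => h.pyramid_subset i hx) hEK) h.volume_ne_top

/-- Meyer's inequality. -/
theorem sum_facets_le (h : IsPolarPair K L) {x : Fin (m + 1) → ℝ} (hx : x ∈ K) :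
    ∑ i, x i * cornerVol (coordProj i.succAbove K) ≤ (m + 1) * cornerVol K := by
  have h1 := h.sum_pyramids_add_le hx MeasurableSet.empty (Set.empty_subset _) (by simp)
  have hm : (0 : ℝ) < m + 1 := by positivity
  rw [measureReal_empty, add_zero] at h1
  calc ∑ i, x i * cornerVol (coordProj i.succAbove K)
      = (m + 1) * ∑ i, x i / (m + 1) * cornerVol (coordProj i.succAbove K) := by
        rw [Finset.mul_sum]
        refine Finset.sum_congr rfl fun i _ => ?_
        field_simp
    _ ≤ _ := mul_le_mul_of_nonneg_left h1 hm.le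

end Pyramids

/-! ### Saint-Raymond's inequality and its inheritance by sections -/

theorem cornerVol_pos {n : ℕ} {K L : Set (Fin n → ℝ)} (h : IsPolarPair K L) : 0 < cornerVol K := by
  rcases Nat.eq_zero_or_pos n with rfl | hn
  · have h1 := h.pow_le_cornerVol (a := 1) zero_le_one (by convert h.zero_mem)
    simp only [pow_zero] at h1
    linarith
  · have hn' : (0 : ℝ) < n := by exact_mod_cast hn
    refine (pow_pos (inv_pos.2 hn') n).trans_le (h.pow_le_cornerVol (inv_nonneg.2 hn'.le) ?_)
    refine (h.mem_left _).2 ⟨fun _ => inv_nonneg.2 hn'.le, fun y hy => ?_⟩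
    calc (fun _ => (n : ℝ)⁻¹) ⬝ᵥ y = ∑ i, (n : ℝ)⁻¹ * y i := rfl
      _ ≤ ∑ _i : Fin n, (n : ℝ)⁻¹ * 1 := Finset.sum_le_sum fun i _ =>
          mul_le_mul_of_nonneg_left (h.symm.le_one hy i) (inv_nonneg.2 hn'.le)
      _ = 1 := by simp [hn'.ne']

/-- Meyer's inequality says that the normalised vector of volumes of coordinate sections of `L`
belongs to `K`. -/
theorem facetVols_mem {m : ℕ} {K L : Set (Fin (m + 1) → ℝ)} (h : IsPolarPair K L) :
    (fun i : Fin (m + 1) => cornerVol (coordProj i.succAbove L) / ((m + 1) * cornerVol L)) ∈ K := by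
  have hpos : 0 < (m + 1) * cornerVol L := mul_pos (by positivity) h.symm.cornerVol_pos
  refine (h.mem_left _).2 ⟨fun i => div_nonneg (cornerVol_nonneg _) hpos.le, fun y hy => ?_⟩
  have h1 := h.symm.sum_facets_le hy
  simp_rw [dotProduct, div_mul_eq_mul_div]
  rw [← Finset.sum_div, div_le_one hpos]
  refine le_trans (le_of_eq ?_) h1
  exact Finset.sum_congr rfl fun i _ => mul_comm _ _

theorem sum_facet_products_le {m : ℕ} {K L : Set (Fin (m + 1) → ℝ)} (h : IsPolarPair K L) :
    ∑ i : Fin (m + 1), cornerVol (coordProj i.succAbove K) * cornerVol (coordProj i.succAbove L)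
      ≤ (m + 1) ^ 2 * (cornerVol K * cornerVol L) := by
  have h1 := h.sum_facets_le h.facetVols_mem
  have hpos : 0 < (m + 1) * cornerVol L := mul_pos (by positivity) h.symm.cornerVol_pos
  simp_rw [div_mul_eq_mul_div] at h1
  rw [← Finset.sum_div, div_le_iff₀ hpos] at h1
  calc _ = ∑ i : Fin (m + 1),
        cornerVol (coordProj i.succAbove L) * cornerVol (coordProj i.succAbove K) :=
        Finset.sum_congr rfl fun i _ => mul_comm _ _
    _ ≤ _ := h1
    _ = _ := by ring

/-- Saint-Raymond's inequality, by Meyer's induction on the dimension. -/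
theorem one_le_factorial_mul {n : ℕ} {K L : Set (Fin n → ℝ)} (h : IsPolarPair K L) :
    1 ≤ n.factorial * (cornerVol K * cornerVol L) := by
  induction n with
  | zero =>
    have h1 := h.pow_le_cornerVol (a := 1) zero_le_one (by convert h.zero_mem)
    have h2 := h.symm.pow_le_cornerVol (a := 1) zero_le_one (by convert h.symm.zero_mem)
    simp only [pow_zero] at h1 h2
    simpa using one_le_mul_of_one_le_of_one_le h1 h2
  | succ m ih =>
    have h1 : ∀ i : Fin (m + 1), 1 / (m.factorial : ℝ)
        ≤ cornerVol (coordProj i.succAbove K) * cornerVol (coordProj i.succAbove L) := by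
      intro i
      rw [div_le_iff₀' (by exact_mod_cast m.factorial_pos)]
      exact ih (h.proj i.succAbove_right_injective)
    have h2 := (Finset.sum_le_sum fun i _ => h1 i).trans h.sum_facet_products_le
    simp only [Finset.sum_const, Finset.card_univ, Fintype.card_fin, nsmul_eq_mul,
      Nat.cast_add, Nat.cast_one] at h2
    have hm : (0 : ℝ) < m + 1 := by positivity
    have hf : (0 : ℝ) < m.factorial := by exact_mod_cast m.factorial_pos
    rw [mul_one_div, div_le_iff₀ hf] at h2
    rw [Nat.factorial_succ]
    push_cast
    nlinarith

/-- A deficit `δ` in Saint-Raymond's inequality grows at most by the factor `m + 1` when passing to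
a coordinate hyperplane section. -/
theorem factorial_mul_facet_le {m : ℕ} {K L : Set (Fin (m + 1) → ℝ)} (h : IsPolarPair K L) {δ : ℝ}
    (hδ : (m + 1).factorial * (cornerVol K * cornerVol L) ≤ 1 + δ) (i : Fin (m + 1)) :
    m.factorial * (cornerVol (coordProj i.succAbove K) * cornerVol (coordProj i.succAbove L))
      ≤ 1 + (m + 1) * δ := by
  have h1 : ∀ i : Fin (m + 1), 0 ≤ m.factorial *
      (cornerVol (coordProj i.succAbove K) * cornerVol (coordProj i.succAbove L)) - 1 := fun i =>
    sub_nonneg.2 (h.proj i.succAbove_right_injective).one_le_factorial_mul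
  have h2 := Finset.single_le_sum (fun i _ => h1 i) (Finset.mem_univ i)
  rw [Finset.sum_sub_distrib, ← Finset.mul_sum] at h2
  simp only [Finset.sum_const, Finset.card_univ, Fintype.card_fin, nsmul_eq_mul,
      Nat.cast_add, Nat.cast_one] at h2
  have h3 := mul_le_mul_of_nonneg_left h.sum_facet_products_le (Nat.cast_nonneg (α := ℝ) m.factorial)
  rw [Nat.factorial_succ] at hδ
  push_cast at hδ
  have hm : (0 : ℝ) ≤ m + 1 := by positivity
  have h4 := mul_le_mul_of_nonneg_left hδ hm
  linarith

theorem cornerVol_permute {k : ℕ} {f : Fin k → Fin k} (hf : f.Injective)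
    (M : Set (Fin k → ℝ)) : cornerVol (coordProj f M) = cornerVol M := by
  let e : Fin k ≃ Fin k := Equiv.ofBijective f (Finite.injective_iff_bijective.1 hf)
  have hp := volume_measurePreserving_piCongrLeft (fun _ : Fin k => ℝ) e
  have h1 := hp.measure_preimage_equiv (M ∩ openOrthant k)
  rw [cornerVol, cornerVol, Measure.real, Measure.real, ← h1]
  congr 2
  ext w
  have hw : ∀ l, (MeasurableEquiv.piCongrLeft (fun _ : Fin k => ℝ) e) w (f l) = w l := fun l =>
    Equiv.piCongrLeft_apply_apply (fun _ : Fin k => ℝ) e w l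
  constructor
  · rintro ⟨⟨x, hx, rfl⟩, hpos⟩
    have : (MeasurableEquiv.piCongrLeft (fun _ : Fin k => ℝ) e) (x ∘ f) = x := by
      ext i
      obtain ⟨l, rfl⟩ := e.surjective i
      exact hw l
    refine ⟨?_, fun i => ?_⟩
    · rw [this]
      exact hx
    · obtain ⟨l, rfl⟩ := e.surjective i
      rw [this]
      exact hpos l
  · rintro ⟨hM, hpos⟩
    refine ⟨⟨_, hM, funext hw⟩, fun l => ?_⟩
    rw [← hw]
    exact hpos (f l)

theorem factorial_mul_coordProj_le {n : ℕ} {K L : Set (Fin n → ℝ)} (h : IsPolarPair K L) {δ : ℝ}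
    (hδ0 : 0 ≤ δ) (hδ : n.factorial * (cornerVol K * cornerVol L) ≤ 1 + δ) {k : ℕ}
    {f : Fin k → Fin n} (hf : f.Injective) :
    k.factorial * (cornerVol (coordProj f K) * cornerVol (coordProj f L)) ≤ 1 + n ^ n * δ := by
  have hkn : k ≤ n := by simpa using Fintype.card_le_of_injective f hf
  obtain ⟨j, hj⟩ := Nat.exists_eq_add_of_le hkn
  suffices h1 : k.factorial * (cornerVol (coordProj f K) * cornerVol (coordProj f L))
      ≤ 1 + n ^ j * δ by
    rcases Nat.eq_zero_or_pos n with rfl | hn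
    · obtain rfl : j = 0 := by omega
      simpa using h1
    · refine h1.trans ?_
      have : (n : ℝ) ^ j ≤ n ^ n := pow_le_pow_right₀ (by exact_mod_cast hn) (by omega)
      nlinarith
  induction j generalizing k with
  | zero =>
    obtain rfl : k = n := by omega
    rw [cornerVol_permute hf, cornerVol_permute hf]
    simpa using hδ
  | succ j ih =>
    obtain ⟨a, ha⟩ : ∃ a, a ∉ Set.range f := by
      by_contra! hc
      have := Fintype.card_le_of_surjective f hc
      simp at this
      omega
    have hg : (Fin.cons a f : Fin (k + 1) → Fin n).Injective := Fin.cons_injective_iff.2 ⟨ha, hf⟩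
    have h1 := ih hg (by simpa using Fintype.card_le_of_injective _ hg) (by omega)
    have h2 := (h.proj hg).factorial_mul_facet_le h1 0
    rw [coordProj_coordProj, coordProj_coordProj] at h2
    have h3 : (Fin.cons a f : Fin (k + 1) → Fin n) ∘ (0 : Fin (k + 1)).succAbove = f := by
      ext l
      simp
    rw [h3] at h2
    refine h2.trans ?_
    have hkn' : (k + 1 : ℝ) ≤ n := by exact_mod_cast (by omega : k + 1 ≤ n)
    have : 0 ≤ (n : ℝ) ^ j * δ := by positivity
    rw [pow_succ]
    nlinarith

end IsPolarPair

/-! ### Corners whose facets are almost cubes -/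

/-- A slab in `ℝᵐ⁺¹`, a box in each slice `y i = const`. It lies just above the hyperplane
`y j + y i (1 - t) / t = 1` through the diagonal point `(t, …, t)` that bounds the pyramid over a
cube in the hyperplane `y i = 0`, where `j` abbreviates `i.succAbove j`. -/
def slab {m : ℕ} (t κ : ℝ) (i : Fin (m + 1)) (j : Fin m) : Set (Fin (m + 1) → ℝ) :=
  {y | (t / 2 < y i ∧ y i < 5 * t / 8) ∧
    ∀ l, y i + (if l = j then 1 - y i / t else 0) < y (i.succAbove l) ∧
      y (i.succAbove l) < y i + (if l = j then 1 - y i / t + κ else 1 / 8)}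

theorem measurableSet_slab {m : ℕ} (t κ : ℝ) (i : Fin (m + 1)) (j : Fin m) :
    MeasurableSet (slab t κ i j) := by
  have : slab t κ i j = ({y | t / 2 < y i} ∩ {y | y i < 5 * t / 8}) ∩
      ⋂ l, ({y | y i + (if l = j then 1 - y i / t else 0) < y (i.succAbove l)} ∩
        {y | y (i.succAbove l) < y i + (if l = j then 1 - y i / t + κ else 1 / 8)}) := by
    ext y
    simp [slab]
  rw [this]
  refine ((measurableSet_lt (by fun_prop) (by fun_prop)).inter
    (measurableSet_lt (by fun_prop) (by fun_prop))).inter (MeasurableSet.iInter fun l => ?_)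
  refine (measurableSet_lt ?_ (by fun_prop)).inter (measurableSet_lt (by fun_prop) ?_)
  all_goals
    split_ifs <;> fun_prop

theorem volume_slab {m : ℕ} {t κ : ℝ} (ht : 0 < t) (hκ : 0 ≤ κ) (i : Fin (m + 1)) (j : Fin m) :
    volume.real (slab t κ i j) = t / 8 * (κ * (1 / 8) ^ (m - 1)) := by
  have hslice : ∀ s : ℝ, volume {w : Fin m → ℝ | i.insertNth s w ∈ slab t κ i j}
      = (Set.Ioo (t / 2) (5 * t / 8)).indicator
        (fun _ => ENNReal.ofReal (κ * (1 / 8) ^ (m - 1))) s := by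
    intro s
    by_cases hs : s ∈ Set.Ioo (t / 2) (5 * t / 8)
    · rw [Set.indicator_of_mem hs]
      have h1 : {w : Fin m → ℝ | i.insertNth s w ∈ slab t κ i j} = Set.univ.pi fun l =>
          Set.Ioo (s + (if l = j then 1 - s / t else 0))
            (s + (if l = j then 1 - s / t + κ else 1 / 8)) := by
        ext w
        simp [slab, hs.1, hs.2]
      rw [h1, Real.volume_pi_Ioo, ← ENNReal.ofReal_prod_of_nonneg]
      · congr 1
        rw [← Finset.mul_prod_erase _ _ (Finset.mem_univ j)]
        congr 1
        · simp
        · rw [Finset.prod_congr rfl (g := fun _ => (1 / 8 : ℝ))]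
          · simp
          · intro l hl
            simp [Finset.ne_of_mem_erase hl]
      · intro l _
        split_ifs
        · linarith
        · linarith
    · rw [Set.indicator_of_notMem hs]
      have h1 : {w : Fin m → ℝ | i.insertNth s w ∈ slab t κ i j} = ∅ := by
        ext w
        simp only [slab, Set.mem_ofPred_eq, Fin.insertNth_apply_same, Set.mem_empty_iff_false,
          iff_false]
        exact fun h => hs h.1
      rw [h1, measure_empty]
  rw [Measure.real, volume_eq_lintegral_slice i (measurableSet_slab t κ i j)]
  simp_rw [hslice]
  rw [lintegral_indicator measurableSet_Ioo, lintegral_const, Measure.restrict_apply_univ,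
    Real.volume_Ioo, ENNReal.toReal_mul, ENNReal.toReal_ofReal (by positivity),
    ENNReal.toReal_ofReal (by linarith)]
  ring

namespace IsPolarPair

variable {m : ℕ} {K L : Set (Fin (m + 1) → ℝ)}

theorem slab_subset (h : IsPolarPair K L) {t γ : ℝ} (ht : 1 / 4 ≤ t) (ht1 : t ≤ 1)
    (htK : (fun _ => t) ∈ K) (hγ0 : 0 ≤ γ) (hγ : γ ≤ 1 / 8) (i : Fin (m + 1))
    (hu : i.insertNth 0 (fun _ => 1 - γ) ∈ K) {z : Fin (m + 1) → ℝ} (hz : z ∈ K) (j : Fin m) :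
    slab t ((z (i.succAbove j) + z i * ((1 - t) / t) - 1) / 8 - γ) i j
      ⊆ K ∩ openOrthant (m + 1) := by
  rintro y ⟨⟨hy1, hy2⟩, hy3⟩
  have ht0 : 0 < t := by linarith
  obtain ⟨r, hr⟩ : ∃ r, r = y i / t := ⟨_, rfl⟩
  have hri : y i = r * t := by rw [hr]; field_simp
  have hr1 : 1 / 2 < r := by rw [hr, lt_div_iff₀ ht0]; linarith
  have hr2 : r < 5 / 8 := by rw [hr, div_lt_iff₀ ht0]; linarith
  have hzi0 := h.nonneg hz i
  have hzi1 := h.le_one hz i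
  obtain ⟨ζ, hζ⟩ : ∃ ζ, ζ = z i / (8 * t) := ⟨_, rfl⟩
  have hζz : z i = 8 * t * ζ := by rw [hζ]; field_simp
  have hζ0 : 0 ≤ ζ := by rw [hζ]; positivity
  have hζ1 : ζ ≤ 1 / 2 := by rw [hζ, div_le_iff₀ (by positivity)]; linarith
  have hpos : ∀ l, 0 < y l := by
    intro l
    rcases Fin.eq_self_or_eq_succAbove i l with rfl | ⟨l, rfl⟩
    · linarith
    · have h1 := (hy3 l).1
      rw [← hr] at h1
      split_ifs at h1 <;> linarith
  refine ⟨?_, hpos⟩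
  -- the point of `K` that dominates `y`: it agrees with `y` in the coordinate `i`
  have hdom := h.comb_mem hz htK hu (a := 1 / 8) (b := r - ζ) (c := 7 / 8 - (r - ζ))
    (by norm_num) (by linarith) (by linarith) (by linarith)
  refine h.mono hdom (fun l => (hpos l).le) fun l => ?_
  rcases Fin.eq_self_or_eq_succAbove i l with rfl | ⟨l, rfl⟩
  · simp only [Pi.add_apply, Pi.smul_apply, smul_eq_mul, Fin.insertNth_apply_same]
    rw [hri, hζz]
    exact le_of_eq (by ring)
  · simp only [Pi.add_apply, Pi.smul_apply, smul_eq_mul, Fin.insertNth_apply_succAbove]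
    have h1 := (hy3 l).2
    rw [← hr, hri] at h1
    have hzl := h.nonneg hz (i.succAbove l)
    have hβγ : (7 / 8 - (r - ζ)) * γ ≤ γ := by nlinarith
    have hζt : 0 ≤ ζ * (1 - t) := mul_nonneg hζ0 (by linarith)
    split_ifs at h1 with hlj
    · subst hlj
      have h2 : z i * ((1 - t) / t) = 8 * (ζ * (1 - t)) := by rw [hζz]; field_simp
      rw [h2] at h1
      nlinarith
    · have : r * (1 - t) + r * t < 5 / 8 := by linarith
      nlinarith

theorem disjoint_pyramid_slab (h : IsPolarPair K L) {t κ : ℝ} (ht : 0 < t) (i i' : Fin (m + 1))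
    (j : Fin m) : Disjoint (pyramid i' (fun _ => t) (facet i' K)) (slab t κ i j) := by
  refine Set.disjoint_left.2 fun y hy hyE => ?_
  obtain ⟨⟨hy1, hy2⟩, hy3⟩ := hyE
  have hr2 : y i / t < 1 := by rw [div_lt_one ht]; linarith
  rcases Fin.eq_self_or_eq_succAbove i i' with rfl | ⟨l, rfl⟩
  · have h1 := (h.proj i'.succAbove_right_injective).le_one hy.2.1 j
    simp only [Pi.smul_apply, smul_eq_mul, Pi.sub_apply, Fin.removeNth_apply,
      div_mul_cancel₀ _ ht.ne'] at h1
    rw [inv_mul_le_iff₀ (by linarith)] at h1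
    have h2 := (hy3 j).1
    rw [if_pos rfl] at h2
    linarith
  · -- in the pyramid over `y i' = 0` the coordinate `i'` is the smallest one
    obtain ⟨l', hl'⟩ := Fin.exists_succAbove_eq (Fin.succAbove_ne i l).symm
    have h1 := lt_of_mem_pyramid hy l'
    rw [hl', div_mul_cancel₀ _ ht.ne'] at h1
    have h2 := (hy3 l).1
    split_ifs at h2 <;> linarith

/-- If every facet of `K` contains the cube of side `1 - γ` and `K` almost attains equality in
Saint-Raymond's inequality, then `K` almost lies below the hyperplanes through the diagonal point
`(t, …, t)` and the faces `{y i = 0, y j = 1}` of the unit cube: a point of `K` beyond one of them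
would add a slab to Meyer's pyramid decomposition with apex `(t, …, t)`. -/
theorem cube_estimate (h : IsPolarPair K L) (hm : 1 ≤ m) {δ γ t : ℝ} (hδ0 : 0 ≤ δ)
    (hδ1 : δ ≤ 1 / 2) (hγ0 : 0 ≤ γ) (hγ1 : (m + 1) * γ ≤ 1 / 4)
    (hδ : (m + 1).factorial * (cornerVol K * cornerVol L) ≤ 1 + δ)
    (hfac : ∀ i : Fin (m + 1), (fun _ => 1 - γ) ∈ coordProj i.succAbove K)
    (ht : t = 1 / ((m + 1).factorial * cornerVol L)) :
    0 < t ∧ t ≤ 1 ∧ (fun _ => t) ∈ K ∧ ∀ z ∈ K, ∀ i j, i ≠ j →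
      z j + z i * ((1 - t) / t) ≤ 1 + 8 ^ (m + 1) * (m + 1) * (δ + γ) := by
  have hm' : (1 : ℝ) ≤ m := by exact_mod_cast hm
  have hL := h.symm.cornerVol_pos
  have hK := h.cornerVol_pos
  have hf : (0 : ℝ) < (m + 1).factorial := by exact_mod_cast (m + 1).factorial_pos
  have hfm : (0 : ℝ) < m.factorial := by exact_mod_cast m.factorial_pos
  have hffm : ((m + 1).factorial : ℝ) = (m + 1) * m.factorial := by
    rw [Nat.factorial_succ]; push_cast; ring
  have ht0 : 0 < t := by rw [ht]; positivity
  have htv : t * ((m + 1).factorial * cornerVol L) = 1 := by rw [ht]; field_simp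
  have htK : (fun _ => t) ∈ K := by
    refine h.mono h.facetVols_mem (fun _ => ht0.le) fun i => ?_
    have hp := h.proj i.succAbove_right_injective
    have h1 := hp.one_le_factorial_mul
    have h2 : 1 ≤ m.factorial * cornerVol (coordProj i.succAbove L) := by
      refine h1.trans (mul_le_mul_of_nonneg_left ?_ hfm.le)
      exact mul_le_of_le_one_left (cornerVol_nonneg _) hp.cornerVol_le_one
    rw [ht, div_le_div_iff₀ (by positivity) (by positivity), hffm]
    nlinarith [mul_pos (by positivity : (0 : ℝ) < m + 1) hL]
  have ht1 : t ≤ 1 := h.le_one htK 0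
  have hvt : cornerVol K ≤ (1 + δ) * t := by
    calc cornerVol K
        = t * ((m + 1).factorial * (cornerVol K * cornerVol L)) := by
          linear_combination (-cornerVol K) * htv
      _ ≤ _ := by rw [mul_comm]; gcongr
  have hγ8 : γ ≤ 1 / 8 := by nlinarith
  have hface : ∀ i : Fin (m + 1), 1 - m * γ ≤ cornerVol (coordProj i.succAbove K) := by
    intro i
    refine le_trans ?_ ((h.proj i.succAbove_right_injective).pow_le_cornerVol (by linarith)
      (hfac i))
    have := one_add_mul_le_pow (a := -γ) (by linarith) m
    rw [← sub_eq_add_neg] at this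
    linarith
  have hu : ∀ i : Fin (m + 1), i.insertNth 0 (fun _ => 1 - γ) ∈ K := fun i =>
    h.insertNth_mem (hfac i)
  have ht4 : 1 / 4 ≤ t := by
    have h1 := h.sum_facets_le (hu 0)
    rw [Fin.sum_univ_succAbove _ 0] at h1
    simp only [Fin.insertNth_apply_same, Fin.insertNth_apply_succAbove, zero_mul, zero_add] at h1
    have h2 : ∑ _i : Fin m, (1 - γ) * (1 - m * γ) ≤ (m + 1) * cornerVol K :=
      (Finset.sum_le_sum fun i _ => mul_le_mul_of_nonneg_left (hface _) (by linarith)).trans h1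
    simp only [Finset.sum_const, Finset.card_univ, Fintype.card_fin, nsmul_eq_mul] at h2
    have h3 : 3 / 4 ≤ (1 - γ) * (1 - m * γ) := by nlinarith [mul_nonneg hγ0 hγ0]
    have h4 : m * (3 / 4) ≤ (m + 1) * ((1 + δ) * t) :=
      (mul_le_mul_of_nonneg_left h3 (by linarith)).trans
        (h2.trans (mul_le_mul_of_nonneg_left hvt (by linarith)))
    have h5 : (1 + δ) * t ≤ 3 / 2 * t := by nlinarith
    nlinarith
  refine ⟨ht0, ht1, htK, fun z hz i j' hij => ?_⟩
  obtain ⟨j, rfl⟩ := Fin.exists_succAbove_eq hij.symm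
  obtain ⟨κ, hκ⟩ : ∃ κ, κ = (z (i.succAbove j) + z i * ((1 - t) / t) - 1) / 8 - γ := ⟨_, rfl⟩
  have hkey : κ ≤ 8 ^ m * (δ + m * γ) := by
    rcases le_or_gt κ 0 with h0 | h0
    · exact h0.trans (by positivity)
    have h1 := h.sum_pyramids_add_le htK (measurableSet_slab t κ i j)
      (by rw [hκ]; exact h.slab_subset ht4 ht1 htK hγ0 hγ8 i (hu i) hz j)
      (fun i' => h.disjoint_pyramid_slab ht0 i i' j)
    rw [volume_slab ht0 h0.le, ← Finset.mul_sum] at h1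
    have h2 : (m + 1) * (1 - m * γ) ≤ ∑ i : Fin (m + 1), cornerVol (coordProj i.succAbove K) := by
      have := Finset.sum_le_sum fun (i : Fin (m + 1)) (_ : i ∈ Finset.univ) => hface i
      simpa only [Finset.sum_const, Finset.card_univ, Fintype.card_fin, nsmul_eq_mul,
        Nat.cast_add, Nat.cast_one] using this
    have h3 : t * (1 - m * γ)
        ≤ t / (m + 1) * ∑ i : Fin (m + 1), cornerVol (coordProj i.succAbove K) := by
      refine le_trans (le_of_eq ?_) (mul_le_mul_of_nonneg_left h2 (by positivity))
      field_simp
    have h4 : t * (κ * (1 / 8) ^ m) ≤ t * (δ + m * γ) := by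
      have : (1 / 8 : ℝ) ^ m = (1 / 8) ^ (m - 1) * (1 / 8) := by
        rw [← pow_succ, Nat.sub_add_cancel hm]
      rw [this]
      nlinarith
    have h5 := le_of_mul_le_mul_left h4 ht0
    rw [one_div, inv_pow, ← div_eq_mul_inv, div_le_iff₀ (by positivity)] at h5
    linarith
  have h8 : (1 : ℝ) ≤ 8 ^ m := one_le_pow₀ (by norm_num)
  have h9 : 0 ≤ (8 : ℝ) ^ m * (m * δ) := by positivity
  rw [pow_succ]
  nlinarith

end IsPolarPair

theorem comp_vecPair {α β : Type*} (f : α → β) (a b : α) : f ∘ ![a, b] = ![f a, f b] := by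
  ext l
  fin_cases l <;> rfl

namespace IsPolarPair

/-- In the plane, a corner that almost attains equality in Saint-Raymond's inequality is almost the
square or almost the triangle. -/
theorem square_or_triangle {K L : Set (Fin 2 → ℝ)} (h : IsPolarPair K L) {δ : ℝ} (hδ0 : 0 ≤ δ)
    (hδ1 : 1536 * δ ≤ 1) (hδ : (2).factorial * (cornerVol K * cornerVol L) ≤ 1 + δ) :
    (fun _ => 1 - 1536 * δ) ∈ K ∨ (fun _ => 1 - 1536 * δ) ∈ L := by
  have hfac : ∀ {M N : Set (Fin 2 → ℝ)}, IsPolarPair M N → ∀ i : Fin 2,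
      (fun _ => 1 - (0 : ℝ)) ∈ coordProj i.succAbove M := by
    intro M N hM i
    have := (hM.proj i.succAbove_right_injective).single_left 0
    convert this using 1
    ext l
    rw [Subsingleton.elim l 0]
    simp
  have hK := h.cornerVol_pos
  have hL := h.symm.cornerVol_pos
  obtain ⟨t, ht⟩ : ∃ t, t = 1 / (((1 + 1).factorial : ℝ) * cornerVol L) := ⟨_, rfl⟩
  obtain ⟨s, hs⟩ : ∃ s, s = 1 / (((1 + 1).factorial : ℝ) * cornerVol K) := ⟨_, rfl⟩
  obtain ⟨ht0, ht1, htK, htz⟩ := h.cube_estimate le_rfl hδ0 (by linarith) le_rfl (by norm_num) hδ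
    (hfac h) ht
  obtain ⟨hs0, hs1, hsL, hsz⟩ := h.symm.cube_estimate le_rfl hδ0 (by linarith) le_rfl (by norm_num)
    (by rwa [mul_comm (cornerVol L)]) (hfac h.symm) hs
  have hst : t * s ≤ 1 / 2 := by
    have h1 := h.one_le_factorial_mul
    simp only [Nat.factorial, Nat.succ_eq_add_one, zero_add, Nat.reduceAdd, mul_one,
      Nat.cast_ofNat] at h1 ht hs
    rw [ht, hs, div_mul_div_comm, div_le_div_iff₀ (by positivity) (by norm_num)]
    nlinarith
  obtain ⟨c, hc⟩ : ∃ c, c = 1 + 128 * δ := ⟨_, rfl⟩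
  have hc1 : 1 ≤ c := by linarith
  have hc0 : 0 < c := by linarith
  obtain ⟨a, ha⟩ : ∃ a, a = (1 - t) / t := ⟨_, rfl⟩
  obtain ⟨b, hb⟩ : ∃ b, b = (1 - s) / s := ⟨_, rfl⟩
  have ha0 : 1 - t ≤ a := by
    rw [ha, le_div_iff₀ ht0]
    nlinarith
  have hb0 : 1 - s ≤ b := by
    rw [hb, le_div_iff₀ hs0]
    nlinarith
  -- the bound on `K` says that a multiple of `(a, 1)` lies in `L`, where the bound on `L` applies
  have hmem : ![a / c, 1 / c] ∈ L := by
    refine (h.mem_right _).2 ⟨?_, fun z hz => ?_⟩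
    · intro l
      fin_cases l
      · exact div_nonneg (by linarith) hc0.le
      · exact div_nonneg zero_le_one hc0.le
    · have h1 := htz z hz 0 1 (by simp)
      rw [← ha] at h1
      have h2 : z ⬝ᵥ ![a / c, 1 / c] = (z 1 + z 0 * a) / c := by
        simp [dotProduct, Fin.sum_univ_two]
        ring
      rw [h2, div_le_one hc0]
      norm_num at h1
      linarith
  have hab := hsz _ hmem 0 1 (by simp)
  rw [← hb] at hab
  norm_num at hab
  have hab2 : a * b ≤ 384 * δ := by
    have h1 : (1 + a * b) / c ≤ c := by
      calc (1 + a * b) / c = c⁻¹ + a / c * b := by field_simp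
        _ ≤ c := by linarith
    rw [div_le_iff₀ hc0] at h1
    nlinarith
  have hprod : (1 - t) * (1 - s) ≤ 384 * δ :=
    (mul_le_mul ha0 hb0 (by linarith) (by linarith)).trans hab2
  rcases le_total s (3 / 4) with hs3 | hs3
  · left
    exact h.mono htK (fun _ => by linarith) fun _ => by nlinarith
  · right
    have ht3 : t ≤ 3 / 4 := by nlinarith
    exact h.symm.mono hsL (fun _ => by linarith) fun _ => by nlinarith

/-- If all planar coordinate sections of `K` are almost squares and `K` almost attains equality in
Saint-Raymond's inequality, then `K` is almost a cube. -/
theorem exists_const_mem (k : ℕ) : ∃ C δ₀ : ℝ, 0 < C ∧ 0 < δ₀ ∧ C * δ₀ ≤ 1 ∧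
    ∀ K L : Set (Fin k → ℝ), IsPolarPair K L → ∀ δ γ : ℝ, 0 ≤ δ → 0 ≤ γ → δ + γ ≤ δ₀ →
      k.factorial * (cornerVol K * cornerVol L) ≤ 1 + δ →
      (∀ i j, i ≠ j → (fun _ => 1 - γ) ∈ coordProj ![i, j] K) →
      (fun _ => 1 - C * (δ + γ)) ∈ K := by
  induction k with
  | zero =>
    refine ⟨1, 1, one_pos, one_pos, by norm_num, fun K L h δ γ _ _ _ _ _ => ?_⟩
    convert h.zero_mem
  | succ m ih =>
    rcases Nat.lt_or_ge m 2 with hm | hm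
    · refine ⟨1, 1, one_pos, one_pos, by norm_num, fun K L h δ γ hδ0 hγ0 hδγ _ hpair => ?_⟩
      interval_cases m
      · refine h.mono (h.single_left 0) (fun _ => by linarith) fun l => ?_
        fin_cases l
        simp
        linarith
      · obtain ⟨x, hx, hx'⟩ := hpair 0 1 (by simp)
        refine h.mono hx (fun _ => by linarith) fun l => ?_
        have h0 := congrFun hx' l
        fin_cases l <;> simp at h0 ⊢ <;> linarith
    · obtain ⟨C, δ₀, hC, hδ₀, hCδ, ih⟩ := ih
      obtain ⟨A, hA⟩ : ∃ A : ℝ, A = 8 ^ (m + 1) * (m + 1) := ⟨_, rfl⟩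
      have hA0 : 0 < A := by rw [hA]; positivity
      have hm0 : (0 : ℝ) < m + 1 := by positivity
      obtain ⟨B, hB⟩ : ∃ B : ℝ, B = C * (m + 1) := ⟨_, rfl⟩
      have hB0 : 0 < B := by rw [hB]; positivity
      obtain ⟨D, hD⟩ : ∃ D : ℝ, D = 2 * ((1 + A) * B + A) := ⟨_, rfl⟩
      have hD0 : 0 < D := by rw [hD]; positivity
      refine ⟨D, min (min (δ₀ / (m + 1)) (1 / 2)) (min (1 / (4 * ((m + 1) * B))) (1 / D)), hD0,
        by positivity, ?_, fun K L h δ γ hδ0 hγ0 hδγ hδ hpair => ?_⟩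
      · calc _ ≤ D * (1 / D) := by
              gcongr
              exact (min_le_right _ _).trans (min_le_right _ _)
          _ = 1 := by field_simp
      obtain ⟨⟨h1, h2⟩, h3, h4⟩ := And.imp le_min_iff.1 le_min_iff.1 (le_min_iff.1 hδγ)
      rw [le_div_iff₀ (by positivity)] at h1 h3 h4
      obtain ⟨e, he⟩ : ∃ e, e = δ + γ := ⟨_, rfl⟩
      rw [← he] at h1 h2 h3 h4 ⊢
      have he0 : 0 ≤ e := by linarith
      have hm1 : (1 : ℝ) ≤ m + 1 := by
        have : (0 : ℝ) ≤ m := by positivity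
        linarith
      have hBe : (m + 1) * (B * e) ≤ 1 / 4 := by linarith
      have hBe0 : 0 ≤ B * e := by positivity
      have hBe8 : B * e ≤ 1 / 4 := by nlinarith
      have hfac : ∀ i : Fin (m + 1), (fun _ => 1 - B * e) ∈ coordProj i.succAbove K := by
        intro i
        have hp := h.proj i.succAbove_right_injective
        have hle : (m + 1) * δ + γ ≤ (m + 1) * e := by rw [he]; nlinarith
        have h5 := ih _ _ hp ((m + 1) * δ) γ (by positivity) hγ0 (by linarith)
          (h.factorial_mul_facet_le hδ i) ?_
        · refine hp.mono h5 (fun _ => by linarith) fun _ => ?_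
          have := mul_le_mul_of_nonneg_left hle hC.le
          rw [hB]
          linarith
        · intro j l hjl
          rw [coordProj_coordProj, comp_vecPair]
          exact hpair _ _ (i.succAbove_right_injective.ne hjl)
      obtain ⟨t, ht⟩ : ∃ t, t = 1 / (((m + 1).factorial : ℝ) * cornerVol L) := ⟨_, rfl⟩
      obtain ⟨ht0, ht1, htK, htz⟩ := h.cube_estimate (by omega) hδ0 (by linarith) hBe0 hBe hδ
        hfac ht
      -- the estimate at the vertex of the cube in a facet `y p = 0` with `p ≠ i, j`
      have h6 := htz _ (h.insertNth_mem (hfac 0)) ((0 : Fin (m + 1)).succAbove ⟨0, by omega⟩)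
        ((0 : Fin (m + 1)).succAbove ⟨1, by omega⟩)
        (Fin.succAbove_right_injective.ne (by simp))
      simp only [Fin.insertNth_apply_succAbove] at h6
      rw [← hA] at h6
      obtain ⟨a, ha⟩ : ∃ a, a = (1 - t) / t := ⟨_, rfl⟩
      rw [← ha] at h6
      have ha0 : 1 - t ≤ a := by
        rw [ha, le_div_iff₀ ht0]
        nlinarith
      have hδe : A * δ ≤ A * e := mul_le_mul_of_nonneg_left (by linarith) hA0.le
      have h7 : 1 - t ≤ D * e := by
        rw [hD]
        nlinarith
      exact h.mono htK (fun _ => by linarith) fun _ => by linarith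

end IsPolarPair

/-! ### Graphs without induced paths on four vertices -/

/-- `a - b - c - d` is an induced path in `G`. -/
structure IsInducedPath {V : Type*} (G : SimpleGraph V) (a b c d : V) : Prop where
  ab : G.Adj a b
  bc : G.Adj b c
  cd : G.Adj c d
  ac : Gᶜ.Adj a c
  ad : Gᶜ.Adj a d
  bd : Gᶜ.Adj b d

namespace IsInducedPath

variable {V : Type*} {G : SimpleGraph V} {a b c d : V}

theorem compl (h : IsInducedPath G a b c d) : IsInducedPath Gᶜ b d a c where
  ab := h.bd
  bc := h.ad.symm
  cd := h.ac
  ac := by simpa using h.ab.symm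
  ad := by simpa using h.bc
  bd := by simpa using h.cd.symm

theorem vec_injective (hp : IsInducedPath G a b c d) : (![a, b, c, d] : Fin 4 → V).Injective := by
    have := hp.ab.ne
    have := hp.ac.ne
    have := hp.ad.ne
    have := hp.bc.ne
    have := hp.bd.ne
    have := hp.cd.ne
    intro i j hij
    fin_cases i <;> fin_cases j <;> simp_all

end IsInducedPath

/-- `S` splits into two non-empty parts with no edges of `G` between them. -/
def SplitsInto {V : Type*} [DecidableEq V] (G : SimpleGraph V) (S : Finset V) : Prop :=
  ∃ A B : Finset V, A.Nonempty ∧ B.Nonempty ∧ A ∪ B = S ∧ ∀ a ∈ A, ∀ b ∈ B, Gᶜ.Adj a b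

section Splitting

variable {V : Type*} [DecidableEq V] {G : SimpleGraph V}

theorem splitsInto_insert_of_nonadj (hG : ∀ a b c d, ¬ IsInducedPath G a b c d) {A B : Finset V}
    (hB : B.Nonempty) (hAB : ∀ a ∈ A, ∀ b ∈ B, Gᶜ.Adj a b) {v y : V} (hvA : v ∉ A) (hvB : v ∉ B)
    (hy : y ∈ A) (hvy : ¬ G.Adj v y) : SplitsInto G (insert v (A ∪ B)) := by
  classical
  by_cases hz : ∃ z ∈ B, G.Adj v z
  · obtain ⟨z, hzB, hvz⟩ := hz
    -- the non-neighbours of `v` in `A` split off, or an edge from them to a neighbour of `v`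
    -- in `A` completes an induced path through `v` and `z`
    refine ⟨A.filter fun a => ¬ G.Adj v a, insert v (A.filter (G.Adj v) ∪ B),
      ⟨y, Finset.mem_filter.2 ⟨hy, hvy⟩⟩, ⟨v, Finset.mem_insert_self _ _⟩, ?_, ?_⟩
    · ext a
      simp only [Finset.mem_union, Finset.mem_insert, Finset.mem_filter]
      tauto
    · intro a ha b hb
      obtain ⟨haA, hva⟩ := Finset.mem_filter.1 ha
      have hav : Gᶜ.Adj v a := by
        rw [SimpleGraph.compl_adj]
        exact ⟨fun h => hvA (h ▸ haA), hva⟩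
      rcases Finset.mem_insert.1 hb with rfl | hb
      · exact hav.symm
      rcases Finset.mem_union.1 hb with hb | hb
      · obtain ⟨hbA, hvb⟩ := Finset.mem_filter.1 hb
        rw [SimpleGraph.compl_adj]
        refine ⟨fun h => hva (h ▸ hvb), fun hab => hG z v b a ?_⟩
        exact ⟨hvz.symm, hvb, hab.symm, (hAB b hbA z hzB).symm, (hAB a haA z hzB).symm, hav⟩
      · exact hAB a haA b hb
  · push Not at hz
    refine ⟨insert v A, B, ⟨v, Finset.mem_insert_self _ _⟩, hB, by rw [Finset.insert_union],
      fun a ha b hb => ?_⟩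
    rcases Finset.mem_insert.1 ha with rfl | ha
    · rw [SimpleGraph.compl_adj]
      exact ⟨fun h => hvB (h ▸ hb), hz b hb⟩
    · exact hAB a ha b hb

theorem splitsInto_insert (hG : ∀ a b c d, ¬ IsInducedPath G a b c d) {S : Finset V} {v : V}
    (hv : v ∉ S) (hS : SplitsInto G S) :
    SplitsInto G (insert v S) ∨ SplitsInto Gᶜ (insert v S) := by
  obtain ⟨A, B, hA, hB, rfl, hAB⟩ := hS
  rw [Finset.mem_union, not_or] at hv
  by_cases h : ∃ y ∈ A ∪ B, ¬ G.Adj v y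
  · left
    obtain ⟨y, hy, hvy⟩ := h
    rcases Finset.mem_union.1 hy with hy | hy
    · exact splitsInto_insert_of_nonadj hG hB hAB hv.1 hv.2 hy hvy
    · rw [Finset.union_comm]
      exact splitsInto_insert_of_nonadj hG hA (fun b hb a ha => (hAB a ha b hb).symm) hv.2 hv.1 hy
        hvy
  · push Not at h
    right
    refine ⟨{v}, A ∪ B, Finset.singleton_nonempty v, hA.mono Finset.subset_union_left,
      (Finset.insert_eq v _).symm, fun a ha b hb => ?_⟩
    rw [Finset.mem_singleton.1 ha, compl_compl]
    exact h b hb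

/-- Seinsche's theorem: a graph without induced path on four vertices is disconnected or has a
disconnected complement. -/
theorem splitsInto_or_compl (hG : ∀ a b c d, ¬ IsInducedPath G a b c d) (S : Finset V)
    (hS : S.Nontrivial) : SplitsInto G S ∨ SplitsInto Gᶜ S := by
  induction S using Finset.induction_on with
  | empty => simp at hS
  | insert v S hv ih =>
    by_cases hS' : S.Nontrivial
    · rcases ih hS' with h | h
      · exact splitsInto_insert hG hv h
      · have hG' : ∀ a b c d, ¬ IsInducedPath Gᶜ a b c d := fun a b c d hp =>
          hG _ _ _ _ (by simpa using hp.compl)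
        have := splitsInto_insert hG' hv h
        rw [compl_compl] at this
        exact this.symm
    · obtain ⟨w, hw, hwv⟩ := hS.exists_ne v
      have hSw : S = {w} := by
        have hwS : w ∈ S := Finset.mem_of_mem_insert_of_ne hw hwv
        ext x
        rw [Finset.mem_singleton]
        refine ⟨fun hx => ?_, fun hx => hx ▸ hwS⟩
        by_contra hne
        exact hS' ⟨x, hx, w, hwS, hne⟩
      have hsplit : ∀ H : SimpleGraph V, Hᶜ.Adj v w → SplitsInto H (insert v S) := by
        intro H hH
        refine ⟨{v}, {w}, Finset.singleton_nonempty v, Finset.singleton_nonempty w, ?_, ?_⟩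
        · rw [hSw, Finset.insert_eq]
        · intro a ha b hb
          rwa [Finset.mem_singleton.1 ha, Finset.mem_singleton.1 hb]
      by_cases hvw : G.Adj v w
      · right
        exact hsplit Gᶜ (by rwa [compl_compl])
      · left
        exact hsplit G ((SimpleGraph.compl_adj _ _ _).2 ⟨hwv.symm, hvw⟩)

end Splitting

/-! ### Excluding induced paths by volume -/

namespace IsPolarPair

variable {n m : ℕ} {K L : Set (Fin n → ℝ)}

theorem mul_facets_le {K L : Set (Fin (m + 1) → ℝ)} (h : IsPolarPair K L) {i j : Fin (m + 1)}
    (hij : i ≠ j) {lam : ℝ} (hK : (fun _ => lam) ∈ coordProj ![i, j] K) :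
    lam * (cornerVol (coordProj i.succAbove K) + cornerVol (coordProj j.succAbove K))
      ≤ (m + 1) * cornerVol K := by
  obtain ⟨x, hx, hxl⟩ := hK
  have hi : x i = lam := congrFun hxl 0
  have hj : x j = lam := congrFun hxl 1
  refine le_trans ?_ (h.sum_facets_le hx)
  calc _ = ∑ p ∈ {i, j}, x p * cornerVol (coordProj p.succAbove K) := by
        rw [Finset.sum_pair hij, hi, hj, mul_add]
    _ ≤ _ := Finset.sum_le_sum_of_subset_of_nonneg (Finset.subset_univ _) fun p _ _ =>
        mul_nonneg (h.nonneg hx p) (cornerVol_nonneg _)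

theorem vecPair_injective {α : Type*} {a b : α} (hab : a ≠ b) : (![a, b] : Fin 2 → α).Injective := by
  intro i j hij
  fin_cases i <;> fin_cases j <;> simp_all

theorem half_le_cornerVol_pair (h : IsPolarPair K L) {a b : Fin n} (hab : a ≠ b) :
    1 / 2 ≤ cornerVol (coordProj ![a, b] K) := by
  have hp := h.proj (vecPair_injective hab)
  have h1 := hp.one_le_factorial_mul
  have h2 := hp.symm.cornerVol_le_one
  have h3 := hp.cornerVol_pos
  norm_num [Nat.factorial] at h1
  nlinarith

/-- The bound on the volume of a three-dimensional section that Meyer's inequality gives at the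
point `lam (e_a + e_c)`. -/
theorem mul_pairs_le (h : IsPolarPair K L) {a b c : Fin n} (hab : a ≠ b) (hbc : b ≠ c) (hac : a ≠ c)
    {lam : ℝ} (hK : (fun _ => lam) ∈ coordProj ![a, c] K) :
    lam * (cornerVol (coordProj ![b, c] K) + cornerVol (coordProj ![a, b] K))
      ≤ 3 * cornerVol (coordProj ![a, b, c] K) := by
  have hinj : (![a, b, c] : Fin 3 → Fin n).Injective := by
    intro i j hij
    fin_cases i <;> fin_cases j <;> simp_all
  have h1 := (h.proj hinj).mul_facets_le (i := 0) (j := 2) (by simp) (lam := lam) (by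
    rw [coordProj_coordProj, comp_vecPair]
    exact hK)
  have e0 : ![a, b, c] ∘ (0 : Fin 3).succAbove = ![b, c] := by
    ext l
    fin_cases l <;> rfl
  have e2 : ![a, b, c] ∘ (2 : Fin 3).succAbove = ![a, b] := by
    ext l
    fin_cases l <;> rfl
  rw [coordProj_coordProj, coordProj_coordProj, e0, e2] at h1
  norm_num at h1
  exact h1

/-- The volume of a section that is almost the stable set polytope of the path `a - b - c - d`.
The polytope has volume `5 / 24`, and its polar, belonging to the complementary path, has the same
volume. -/
theorem le_cornerVol_path (h : IsPolarPair K L) {G : SimpleGraph (Fin n)} {a b c d : Fin n}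
    (hp : IsInducedPath G a b c d) {lam : ℝ} (h0 : 0 ≤ lam) (h1 : lam ≤ 1)
    (hK : ∀ i j, Gᶜ.Adj i j → (fun _ => lam) ∈ coordProj ![i, j] K) :
    5 / 24 * lam ^ 4 ≤ cornerVol (coordProj ![a, b, c, d] K) := by
  have hinj := hp.vec_injective
  have hbcd := h.mul_pairs_le hp.bc.ne hp.cd.ne hp.bd.ne (hK _ _ hp.bd)
  have habd := h.mul_pairs_le hp.ab.ne hp.bd.ne hp.ad.ne (hK _ _ hp.ad)
  have hcd := h.half_le_cornerVol_pair hp.cd.ne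
  have hbc := h.half_le_cornerVol_pair hp.bc.ne
  have hab := h.half_le_cornerVol_pair hp.ab.ne
  have hbd := (h.proj (vecPair_injective hp.bd.ne)).pow_le_cornerVol h0 (hK _ _ hp.bd)
  have h2 := (h.proj hinj).mul_facets_le (i := 0) (j := 2) (by simp) (lam := lam) (by
    rw [coordProj_coordProj, comp_vecPair]
    exact hK _ _ hp.ac)
  have e0 : ![a, b, c, d] ∘ (0 : Fin 4).succAbove = ![b, c, d] := by
    ext l
    fin_cases l <;> rfl
  have e2 : ![a, b, c, d] ∘ (2 : Fin 4).succAbove = ![a, b, d] := by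
    ext l
    fin_cases l <;> rfl
  rw [coordProj_coordProj, coordProj_coordProj, e0, e2] at h2
  norm_num at h2
  have h3 : lam * (1 / 2 + 1 / 2) ≤ 3 * cornerVol (coordProj ![b, c, d] K) :=
    (mul_le_mul_of_nonneg_left (by linarith) h0).trans hbcd
  have h4 : lam * (lam ^ 2 + 1 / 2) ≤ 3 * cornerVol (coordProj ![a, b, d] K) :=
    (mul_le_mul_of_nonneg_left (by linarith) h0).trans habd
  have hsq : lam ^ 2 ≤ 1 := pow_le_one₀ h0 h1
  have h5 : 5 / 2 * lam ^ 3 ≤ lam * 1 + lam * (lam ^ 2 + 1 / 2) := by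
    have := mul_le_mul_of_nonneg_left hsq h0
    nlinarith
  have h6 := mul_le_mul_of_nonneg_left (h5.trans (by linarith : _ ≤
    3 * (cornerVol (coordProj ![b, c, d] K) + cornerVol (coordProj ![a, b, d] K)))) h0
  nlinarith

/-- An induced path on four vertices would make a four-dimensional section violate almost equality
in Saint-Raymond's inequality, since `(5 / 24) ^ 2 > 1 / 4!`. -/
theorem not_isInducedPath (h : IsPolarPair K L) {G : SimpleGraph (Fin n)} {δ γ : ℝ}
    (hδ1 : δ ≤ 1 / 1000) (hγ0 : 0 ≤ γ) (hγ1 : γ ≤ 1 / 1000)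
    (hδ : ∀ f : Fin 4 → Fin n, f.Injective →
      (4).factorial * (cornerVol (coordProj f K) * cornerVol (coordProj f L)) ≤ 1 + δ)
    (hK : ∀ i j, Gᶜ.Adj i j → (fun _ => 1 - γ) ∈ coordProj ![i, j] K)
    (hL : ∀ i j, G.Adj i j → (fun _ => 1 - γ) ∈ coordProj ![i, j] L) (a b c d : Fin n) :
    ¬ IsInducedPath G a b c d := by
  intro hp
  have hinj := hp.vec_injective
  have h1 := h.le_cornerVol_path hp (by linarith) (by linarith) hK
  have h2 := h.symm.le_cornerVol_path hp.compl (lam := 1 - γ) (by linarith) (by linarith) (by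
    rw [compl_compl]
    exact hL)
  have e : ![b, d, a, c] = ![a, b, c, d] ∘ ![1, 3, 0, 2] := by
    ext l
    fin_cases l <;> rfl
  rw [e, ← coordProj_coordProj, cornerVol_permute (by decide)] at h2
  have h3 := hδ _ hinj
  have hpow : 99 / 100 ≤ (1 - γ) ^ 8 := by
    have := one_add_mul_le_pow (a := -γ) (by linarith) 8
    rw [← sub_eq_add_neg] at this
    norm_num at this
    linarith
  have h4 : 5 / 24 * (1 - γ) ^ 4 * (5 / 24 * (1 - γ) ^ 4)
      ≤ cornerVol (coordProj ![a, b, c, d] K) * cornerVol (coordProj ![a, b, c, d] L) :=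
    mul_le_mul h1 h2 (by positivity) (cornerVol_nonneg _)
  have h5 : 5 / 24 * (1 - γ) ^ 4 * (5 / 24 * (1 - γ) ^ 4) = 25 / 576 * (1 - γ) ^ 8 := by ring
  norm_num [Nat.factorial] at h3
  -- the contradiction is `25 / 24 > 1`
  linarith

/-! ### The graph of an almost extremal pair -/

/-- `exists_const_mem` with constants that serve all dimensions up to `n`. -/
theorem exists_const_mem_le (n : ℕ) : ∃ C δ₀ : ℝ, 0 < C ∧ 0 < δ₀ ∧ C * δ₀ ≤ 1 ∧ ∀ k ≤ n,
    ∀ K L : Set (Fin k → ℝ), IsPolarPair K L → ∀ δ γ : ℝ, 0 ≤ δ → 0 ≤ γ → δ + γ ≤ δ₀ →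
      k.factorial * (cornerVol K * cornerVol L) ≤ 1 + δ →
      (∀ i j, i ≠ j → (fun _ => 1 - γ) ∈ coordProj ![i, j] K) →
      (fun _ => 1 - C * (δ + γ)) ∈ K := by
  induction n with
  | zero =>
    obtain ⟨C, δ₀, hC, hδ₀, hCδ, h⟩ := exists_const_mem 0
    refine ⟨C, δ₀, hC, hδ₀, hCδ, fun k hk => ?_⟩
    obtain rfl : k = 0 := by omega
    exact h
  | succ n ih =>
    obtain ⟨C, δ₀, hC, hδ₀, hCδ, h⟩ := exists_const_mem (n + 1)
    obtain ⟨C', δ₀', hC', hδ₀', hCδ', h'⟩ := ih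
    refine ⟨max C C', min (min δ₀ δ₀') (1 / max C C'), by positivity, by positivity, ?_,
      fun k hk K L hKL δ γ hδ0 hγ0 hδγ hδ hpair => ?_⟩
    · calc _ ≤ max C C' * (1 / max C C') := by
            gcongr
            exact min_le_right _ _
        _ = 1 := by
            have : max C C' ≠ 0 := by positivity
            field_simp
    have hmax : 0 < max C C' := by positivity
    obtain ⟨⟨h1, h2⟩, h3⟩ := And.imp_left le_min_iff.1 (le_min_iff.1 hδγ)
    rw [le_div_iff₀' hmax] at h3
    have hle := mul_le_mul_of_nonneg_right (le_max_left C C') (by linarith : 0 ≤ δ + γ)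
    have hle' := mul_le_mul_of_nonneg_right (le_max_right C C') (by linarith : 0 ≤ δ + γ)
    rcases Nat.lt_or_ge n k with hk' | hk'
    · obtain rfl : k = n + 1 := by omega
      exact hKL.mono (h K L hKL δ γ hδ0 hγ0 h1 hδ hpair) (fun _ => by linarith)
        fun _ => by linarith
    · exact hKL.mono (h' k hk' K L hKL δ γ hδ0 hγ0 h2 hδ hpair) (fun _ => by linarith)
        fun _ => by linarith

theorem indicator_mem (h : IsPolarPair K L) {H : SimpleGraph (Fin n)} {C δ₀ δ γ : ℝ}
    (hδ0 : 0 ≤ δ) (hγ0 : 0 ≤ γ) (hδγ : δ + γ ≤ δ₀)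
    (hC : ∀ k ≤ n, ∀ K L : Set (Fin k → ℝ), IsPolarPair K L → ∀ δ γ : ℝ, 0 ≤ δ → 0 ≤ γ →
      δ + γ ≤ δ₀ → k.factorial * (cornerVol K * cornerVol L) ≤ 1 + δ →
      (∀ i j, i ≠ j → (fun _ => 1 - γ) ∈ coordProj ![i, j] K) →
      (fun _ => 1 - C * (δ + γ)) ∈ K)
    (hδ : ∀ (k : ℕ) (f : Fin k → Fin n), f.Injective →
      k.factorial * (cornerVol (coordProj f K) * cornerVol (coordProj f L)) ≤ 1 + δ)
    (hK : ∀ i j, H.Adj i j → (fun _ => 1 - γ) ∈ coordProj ![i, j] K) (I : Finset (Fin n))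
    (hI : ∀ i ∈ I, ∀ j ∈ I, i ≠ j → H.Adj i j) :
    (fun i => if i ∈ I then 1 - C * (δ + γ) else 0) ∈ K := by
  let f : Fin I.card → Fin n := I.orderEmbOfFin rfl
  have hf : f.Injective := (I.orderEmbOfFin rfl).injective
  have hrange : Set.range f = I := I.range_orderEmbOfFin rfl
  have hfI : ∀ l, f l ∈ I := I.orderEmbOfFin_mem rfl
  have hcard : I.card ≤ n := by simpa using I.card_le_univ
  have h1 := hC _ hcard _ _ (h.proj hf) δ γ hδ0 hγ0 hδγ (hδ _ f hf) fun i j hij => by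
    rw [coordProj_coordProj, comp_vecPair]
    exact hK _ _ (hI _ (hfI i) _ (hfI j) (hf.ne hij))
  obtain ⟨x, hx, hx1, hx0⟩ := h.extend_mem h1
  convert hx using 1
  ext i
  split_ifs with hi
  · rw [← Finset.mem_coe, ← hrange] at hi
    obtain ⟨l, rfl⟩ := hi
    exact (congrFun hx1 l).symm
  · rw [← Finset.mem_coe, ← hrange] at hi
    exact (hx0 i hi).symm

/-- Stability of Saint-Raymond's inequality on the level of corners: a corner that almost attains
equality almost contains the stable set polytope of a graph without induced paths on four vertices,
and its polar almost contains that of the complementary graph. -/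
theorem exists_graph (n : ℕ) : ∃ C δ₀ : ℝ, 0 < C ∧ 0 < δ₀ ∧ C * δ₀ ≤ 1 / 4 ∧
    ∀ (K L : Set (Fin n → ℝ)) (δ : ℝ), IsPolarPair K L → 0 ≤ δ → δ ≤ δ₀ →
      n.factorial * (cornerVol K * cornerVol L) ≤ 1 + δ →
      ∃ G : SimpleGraph (Fin n), (∀ a b c d, ¬ IsInducedPath G a b c d) ∧
        (∀ I : Finset (Fin n), (∀ i ∈ I, ∀ j ∈ I, ¬ G.Adj i j) →
          (fun i => if i ∈ I then 1 - C * δ else 0) ∈ K) ∧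
        ∀ T : Finset (Fin n), (∀ i ∈ T, ∀ j ∈ T, i ≠ j → G.Adj i j) →
          (fun i => if i ∈ T then 1 - C * δ else 0) ∈ L := by
  obtain ⟨C, δ₀, hC, hδ₀, -, hmem⟩ := exists_const_mem_le n
  obtain ⟨N, hN⟩ : ∃ N : ℝ, N = n ^ n + 1 := ⟨_, rfl⟩
  have hN0 : 0 < N := by rw [hN]; positivity
  refine ⟨C * (1537 * N), min (min (δ₀ / (1537 * N)) (1 / 1000 / (1537 * N)))
    (1 / (4 * (C * (1537 * N)))), by positivity, by positivity, ?_, ?_⟩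
  · calc _ ≤ C * (1537 * N) * (1 / (4 * (C * (1537 * N)))) := by
          gcongr
          exact min_le_right _ _
      _ = 1 / 4 := by field_simp
  intro K L δ h hδ0 hδ1 hδ
  obtain ⟨⟨h1, h2⟩, -⟩ := And.imp_left le_min_iff.1 (le_min_iff.1 hδ1)
  rw [le_div_iff₀ (by positivity)] at h1 h2
  obtain ⟨δ', hδ'⟩ : ∃ δ', δ' = N * δ := ⟨_, rfl⟩
  have hδ'0 : 0 ≤ δ' := by rw [hδ']; positivity
  have hsec : ∀ (k : ℕ) (f : Fin k → Fin n), f.Injective →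
      k.factorial * (cornerVol (coordProj f K) * cornerVol (coordProj f L)) ≤ 1 + δ' := by
    intro k f hf
    refine (h.factorial_mul_coordProj_le hδ0 hδ hf).trans ?_
    rw [hδ', hN]
    linarith
  have hsec' : ∀ (k : ℕ) (f : Fin k → Fin n), f.Injective →
      k.factorial * (cornerVol (coordProj f L) * cornerVol (coordProj f K)) ≤ 1 + δ' := by
    intro k f hf
    rw [mul_comm (cornerVol _)]
    exact hsec k f hf
  let G : SimpleGraph (Fin n) :=
    { Adj := fun i j => i ≠ j ∧ (fun _ => 1 - 1536 * δ') ∈ coordProj ![i, j] L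
      symm := ⟨fun i j hij => by
        refine ⟨hij.1.symm, ?_⟩
        obtain ⟨x, hx, hxl⟩ := hij.2
        refine ⟨x, hx, ?_⟩
        ext l
        fin_cases l
        exacts [congrFun hxl 1, congrFun hxl 0]⟩
      loopless := ⟨fun i hi => hi.1 rfl⟩ }
  have hL : ∀ i j, G.Adj i j → (fun _ => 1 - 1536 * δ') ∈ coordProj ![i, j] L := fun i j hij =>
    hij.2
  have hK : ∀ i j, Gᶜ.Adj i j → (fun _ => 1 - 1536 * δ') ∈ coordProj ![i, j] K := by
    intro i j hij
    rw [SimpleGraph.compl_adj] at hij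
    have hinj := vecPair_injective hij.1
    refine ((h.proj hinj).square_or_triangle hδ'0 (by linarith) (hsec 2 _ hinj)).resolve_right ?_
    exact fun hmemL => hij.2 ⟨hij.1, hmemL⟩
  have hCδ : C * (1537 * N) * δ = C * (δ' + 1536 * δ') := by rw [hδ']; ring
  refine ⟨G, ?_, fun I hI => ?_, fun T hT => ?_⟩
  · exact h.not_isInducedPath (by linarith) (by linarith) (by linarith) (fun f hf => hsec 4 f hf)
      hK hL
  · rw [hCδ]
    refine h.indicator_mem hδ'0 (by linarith) (by linarith) hmem hsec hK I fun i hi j hj hij => ?_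
    rw [SimpleGraph.compl_adj]
    exact ⟨hij, hI i hi j hj⟩
  · rw [hCδ]
    exact h.symm.indicator_mem hδ'0 (by linarith) (by linarith) hmem hsec' hL T hT

end IsPolarPair

/-! ### Hanner polytopes from graphs -/

section HannerOfGraph

variable {n : ℕ} {G : SimpleGraph (Fin n)} {S A B : Finset (Fin n)}

/-- The vectors with entries `0, 1, -1` whose support is an independent set of `G` inside `S`. -/
def signedIndep (G : SimpleGraph (Fin n)) (S : Finset (Fin n)) : Set (EuclideanSpace ℝ (Fin n)) :=
  {x | (∀ i, x i = 0 ∨ x i = 1 ∨ x i = -1) ∧ (∀ i, x i ≠ 0 → i ∈ S) ∧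
    ∀ i j, x i ≠ 0 → x j ≠ 0 → ¬ G.Adj i j}

/-- The unconditional hull of the stable set polytope of the subgraph of `G` induced on `S`. -/
def stablePolytope (G : SimpleGraph (Fin n)) (S : Finset (Fin n)) :
    Set (EuclideanSpace ℝ (Fin n)) :=
  convexHull ℝ (signedIndep G S)

theorem zero_mem_stablePolytope : (0 : EuclideanSpace ℝ (Fin n)) ∈ stablePolytope G S :=
  subset_convexHull ℝ _ ⟨by simp, by simp, by simp⟩

theorem convex_stablePolytope : Convex ℝ (stablePolytope G S) := convex_convexHull ℝ _

theorem stablePolytope_mono (h : A ⊆ S) : stablePolytope G A ⊆ stablePolytope G S :=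
  convexHull_mono fun _ hx => ⟨hx.1, fun i hi => h (hx.2.1 i hi), hx.2.2⟩

theorem eq_zero_of_mem_span_stablePolytope {x : EuclideanSpace ℝ (Fin n)}
    (hx : x ∈ Submodule.span ℝ (stablePolytope G S)) {i : Fin n} (hi : i ∉ S) : x i = 0 := by
  have hle : Submodule.span ℝ (stablePolytope G S)
      ≤ LinearMap.ker (EuclideanSpace.proj i : EuclideanSpace ℝ (Fin n) →L[ℝ] ℝ).toLinearMap := by
    refine Submodule.span_le.2 (convexHull_min (fun y hy => ?_) (Submodule.convex _))
    by_contra hne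
    exact hi (hy.2.1 i hne)
  exact hle hx

theorem disjoint_span_stablePolytope (hAB : ∀ a ∈ A, a ∉ B) :
    Disjoint (Submodule.span ℝ (stablePolytope G A)) (Submodule.span ℝ (stablePolytope G B)) := by
  refine Submodule.disjoint_def.2 fun x hA hB => ?_
  ext i
  by_cases hi : i ∈ A
  · exact eq_zero_of_mem_span_stablePolytope hB (hAB i hi)
  · exact eq_zero_of_mem_span_stablePolytope hA hi

theorem single_mem_stablePolytope (i : Fin n) {c : ℝ} (hc : |c| ≤ 1) :
    EuclideanSpace.single i c ∈ stablePolytope G {i} := by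
  have hv : ∀ s : ℝ, s = 1 ∨ s = -1 → EuclideanSpace.single i s ∈ stablePolytope G {i} := by
    intro s hs
    refine subset_convexHull ℝ _ ⟨fun j => ?_, fun j hj => ?_, fun j l hj hl => ?_⟩
    · by_cases hj : j = i
      · subst hj
        simpa using Or.inr hs
      · simp [hj]
    · by_contra hne
      simp_all
    · have hj' : j = i := by
        by_contra hne
        simp_all
      have hl' : l = i := by
        by_contra hne
        simp_all
      rw [hj', hl']
      exact G.irrefl
  obtain ⟨h1, h2⟩ := abs_le.1 hc
  have := convex_stablePolytope (hv 1 (Or.inl rfl)) (hv (-1) (Or.inr rfl))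
    (by linarith : 0 ≤ (1 + c) / 2) (by linarith : 0 ≤ (1 - c) / 2) (by ring)
  convert this
  ext j
  by_cases hj : j = i
  · subst hj
    simp
    ring
  · simp [hj]

theorem stablePolytope_singleton (i : Fin n) : stablePolytope G {i} =
    segment ℝ (-(EuclideanSpace.single i (1 : ℝ))) (EuclideanSpace.single i 1) := by
  refine Set.Subset.antisymm (convexHull_min (fun x hx => ?_) (convex_segment _ _))
    (convex_stablePolytope.segment_subset ?_ (single_mem_stablePolytope i (by simp)))
  · have hx' : x = EuclideanSpace.single i (x i) := by
      ext j
      by_cases hj : j = i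
      · subst hj
        simp
      · have : x j = 0 := by
          by_contra hne
          exact hj (Finset.mem_singleton.1 (hx.2.1 j hne))
        simp [hj, this]
    refine ⟨(1 - x i) / 2, (1 + x i) / 2, ?_, ?_, by ring, ?_⟩
    · rcases hx.1 i with h | h | h <;> rw [h] <;> norm_num
    · rcases hx.1 i with h | h | h <;> rw [h] <;> norm_num
    · conv_rhs => rw [hx']
      ext j
      by_cases hj : j = i
      · subst hj
        simp
        ring
      · simp [hj]
  · have := single_mem_stablePolytope (G := G) i (c := -1) (by simp)
    convert this
    ext j
    by_cases hj : j = i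
    · subst hj
      simp
    · simp [hj]

/-- The restriction of a vector to the coordinates in `A`. -/
noncomputable def restrictCoord (A : Finset (Fin n)) (x : EuclideanSpace ℝ (Fin n)) :
    EuclideanSpace ℝ (Fin n) :=
  WithLp.toLp 2 fun i => if i ∈ A then x i else 0

theorem restrictCoord_apply (x : EuclideanSpace ℝ (Fin n)) (i : Fin n) :
    restrictCoord A x i = if i ∈ A then x i else 0 := rfl

theorem restrictCoord_add_restrictCoord (hAB : ∀ a ∈ A, a ∉ B) {x : EuclideanSpace ℝ (Fin n)}
    (hx : ∀ i, x i ≠ 0 → i ∈ A ∪ B) : restrictCoord A x + restrictCoord B x = x := by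
  ext i
  rw [PiLp.add_apply, restrictCoord_apply, restrictCoord_apply]
  by_cases hA : i ∈ A
  · simp [hA, hAB i hA]
  · by_cases hB : i ∈ B
    · simp [hA, hB]
    · have : x i = 0 := by
        by_contra hne
        exact (Finset.mem_union.1 (hx i hne)).elim hA hB
      simp [hA, hB, this]

/-- A disjoint union of graphs gives an `ℓ_∞`-sum. -/
theorem stablePolytope_union (hAB : ∀ a ∈ A, ∀ b ∈ B, Gᶜ.Adj a b) :
    stablePolytope G (A ∪ B) = stablePolytope G A + stablePolytope G B := by
  have hdisj : ∀ a ∈ A, a ∉ B := fun a ha hb => (hAB a ha a hb).ne rfl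
  rw [stablePolytope, stablePolytope, stablePolytope, ← convexHull_add]
  congr 1
  ext x
  constructor
  · intro hx
    refine ⟨restrictCoord A x, ⟨fun i => ?_, fun i hi => ?_, fun i j hi hj => ?_⟩,
      restrictCoord B x, ⟨fun i => ?_, fun i hi => ?_, fun i j hi hj => ?_⟩,
      restrictCoord_add_restrictCoord hdisj hx.2.1⟩
    all_goals simp only [restrictCoord_apply] at *
    · split_ifs
      exacts [hx.1 i, Or.inl rfl]
    · by_contra hne
      simp [hne] at hi
    · split_ifs at hi hj
      exacts [hx.2.2 i j hi hj, absurd rfl hj, absurd rfl hi, absurd rfl hi]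
    · split_ifs
      exacts [hx.1 i, Or.inl rfl]
    · by_contra hne
      simp [hne] at hi
    · split_ifs at hi hj
      exacts [hx.2.2 i j hi hj, absurd rfl hj, absurd rfl hi, absurd rfl hi]
  · rintro ⟨y, hy, z, hz, rfl⟩
    have hyz : ∀ i, i ∈ A → z i = 0 := fun i hi => by
      by_contra hne
      exact hdisj i hi (hz.2.1 i hne)
    have hzy : ∀ i, i ∉ A → y i = 0 := fun i hi => by
      by_contra hne
      exact hi (hy.2.1 i hne)
    refine ⟨fun i => ?_, fun i hi => ?_, fun i j hi hj => ?_⟩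
    · by_cases hi : i ∈ A
      · simpa [hyz i hi] using hy.1 i
      · simpa [hzy i hi] using hz.1 i
    · by_cases hiA : i ∈ A
      · exact Finset.mem_union_left _ hiA
      · refine Finset.mem_union_right _ (hz.2.1 i ?_)
        simpa [hzy i hiA] using hi
    · by_cases hiA : i ∈ A <;> by_cases hjA : j ∈ A <;>
        simp only [PiLp.add_apply, hyz _, hzy _, hiA, hjA, not_false_eq_true, add_zero,
          zero_add] at hi hj
      · exact hy.2.2 i j hi hj
      · exact ((SimpleGraph.compl_adj _ _ _).1 (hAB i hiA j (hz.2.1 j hj))).2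
      · exact fun h => ((SimpleGraph.compl_adj _ _ _).1 (hAB j hjA i (hz.2.1 i hi))).2 h.symm
      · exact hz.2.2 i j hi hj

/-- A join of graphs gives an `ℓ₁`-sum. -/
theorem stablePolytope_join (hAB : ∀ a ∈ A, ∀ b ∈ B, G.Adj a b) :
    stablePolytope G (A ∪ B) = convexHull ℝ (stablePolytope G A ∪ stablePolytope G B) := by
  have h1 : signedIndep G (A ∪ B) = signedIndep G A ∪ signedIndep G B := by
    ext x
    constructor
    · intro hx
      by_cases h : ∃ a ∈ A, x a ≠ 0
      · obtain ⟨a, ha, hxa⟩ := h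
        refine Or.inl ⟨hx.1, fun i hi => ?_, hx.2.2⟩
        refine (Finset.mem_union.1 (hx.2.1 i hi)).resolve_right fun hiB => ?_
        exact hx.2.2 a i hxa hi (hAB a ha i hiB)
      · push Not at h
        refine Or.inr ⟨hx.1, fun i hi => ?_, hx.2.2⟩
        exact (Finset.mem_union.1 (hx.2.1 i hi)).resolve_left fun hiA => hi (h i hiA)
    · rintro (hx | hx)
      · exact ⟨hx.1, fun i hi => Finset.mem_union_left _ (hx.2.1 i hi), hx.2.2⟩
      · exact ⟨hx.1, fun i hi => Finset.mem_union_right _ (hx.2.1 i hi), hx.2.2⟩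
  rw [stablePolytope, h1, stablePolytope, stablePolytope, convexHull_convexHull_union_left,
    convexHull_convexHull_union_right]

/-- The polytope `stablePolytope G S` is cut out by the inequalities `∑ i ∈ T, |x i| ≤ 1` for the
cliques `T` of `G` inside `S`; stated for all dilates, so that it passes to joins. -/
def CliqueDetermined (G : SimpleGraph (Fin n)) (S : Finset (Fin n)) : Prop :=
  ∀ r : ℝ, ∀ x : EuclideanSpace ℝ (Fin n), (∀ i, x i ≠ 0 → i ∈ S) →
    (∀ T ⊆ S, (∀ i ∈ T, ∀ j ∈ T, i ≠ j → G.Adj i j) → ∑ i ∈ T, |x i| ≤ r) →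
    x ∈ r • stablePolytope G S

theorem cliqueDetermined_singleton (i : Fin n) : CliqueDetermined G {i} := by
  intro r x hx hT
  have h1 : |x i| ≤ r := by simpa using hT {i} subset_rfl (by simp)
  have hx' : x = EuclideanSpace.single i (x i) := by
    ext j
    by_cases hj : j = i
    · subst hj
      simp
    · have : x j = 0 := by
        by_contra hne
        exact hj (Finset.mem_singleton.1 (hx j hne))
      simp [hj, this]
  rcases (abs_nonneg (x i)).trans h1 |>.eq_or_lt with h0 | h0
  · have hxi : x i = 0 := abs_nonpos_iff.1 (h0 ▸ h1)
    refine ⟨0, zero_mem_stablePolytope, ?_⟩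
    rw [hx', hxi]
    ext j
    simp
  · refine ⟨EuclideanSpace.single i (x i / r), single_mem_stablePolytope i ?_, ?_⟩
    · rw [abs_div, abs_of_pos h0, div_le_one h0]
      exact h1
    · conv_rhs => rw [hx']
      ext j
      by_cases hj : j = i
      · subst hj
        simp
        field_simp
      · simp [hj]

theorem sum_abs_restrictCoord {T : Finset (Fin n)} (hT : T ⊆ A) (x : EuclideanSpace ℝ (Fin n)) :
    ∑ i ∈ T, |restrictCoord A x i| = ∑ i ∈ T, |x i| :=
  Finset.sum_congr rfl fun i hi => by rw [restrictCoord_apply, if_pos (hT hi)]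

theorem restrictCoord_support (x : EuclideanSpace ℝ (Fin n)) (i : Fin n)
    (hi : restrictCoord A x i ≠ 0) : i ∈ A := by
  by_contra hne
  simp [restrictCoord_apply, hne] at hi

theorem CliqueDetermined.union (hA : CliqueDetermined G A) (hB : CliqueDetermined G B)
    (hAB : ∀ a ∈ A, ∀ b ∈ B, Gᶜ.Adj a b) : CliqueDetermined G (A ∪ B) := by
  intro r x hx hT
  have hdisj : ∀ a ∈ A, a ∉ B := fun a ha hb => (hAB a ha a hb).ne rfl
  rw [stablePolytope_union hAB, smul_add, ← restrictCoord_add_restrictCoord hdisj hx]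
  refine Set.add_mem_add (hA r _ (restrictCoord_support x) fun T hTA hcl => ?_)
    (hB r _ (restrictCoord_support x) fun T hTB hcl => ?_)
  · rw [sum_abs_restrictCoord hTA]
    exact hT T (hTA.trans Finset.subset_union_left) hcl
  · rw [sum_abs_restrictCoord hTB]
    exact hT T (hTB.trans Finset.subset_union_right) hcl

theorem exists_max_clique (G : SimpleGraph (Fin n)) (A : Finset (Fin n))
    (x : EuclideanSpace ℝ (Fin n)) :
    ∃ T ⊆ A, (∀ i ∈ T, ∀ j ∈ T, i ≠ j → G.Adj i j) ∧
      ∀ T' ⊆ A, (∀ i ∈ T', ∀ j ∈ T', i ≠ j → G.Adj i j) → ∑ i ∈ T', |x i| ≤ ∑ i ∈ T, |x i| := by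
  classical
  obtain ⟨T, hT, hmax⟩ := (A.powerset.filter fun T => ∀ i ∈ T, ∀ j ∈ T, i ≠ j →
    G.Adj i j).exists_max_image (fun T => ∑ i ∈ T, |x i|) ⟨∅, by simp⟩
  simp only [Finset.mem_filter, Finset.mem_powerset] at hT hmax
  exact ⟨T, hT.1, hT.2, fun T' h1 h2 => hmax T' ⟨h1, h2⟩⟩

theorem CliqueDetermined.join (hA : CliqueDetermined G A) (hB : CliqueDetermined G B)
    (hAB : ∀ a ∈ A, ∀ b ∈ B, G.Adj a b) : CliqueDetermined G (A ∪ B) := by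
  intro r x hx hT
  have hdisj : ∀ a ∈ A, a ∉ B := fun a ha hb => (hAB a ha a hb).ne rfl
  obtain ⟨TA, hTA, hclA, hmaxA⟩ := exists_max_clique G A x
  obtain ⟨TB, hTB, hclB, hmaxB⟩ := exists_max_clique G B x
  have hsum : ∑ i ∈ TA, |x i| + ∑ i ∈ TB, |x i| ≤ r := by
    rw [← Finset.sum_union (Finset.disjoint_left.2 fun a ha hb => hdisj a (hTA ha) (hTB hb))]
    refine hT _ (Finset.union_subset_union hTA hTB) fun i hi j hj hij => ?_
    rcases Finset.mem_union.1 hi with hi | hi <;> rcases Finset.mem_union.1 hj with hj | hj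
    · exact hclA i hi j hj hij
    · exact hAB i (hTA hi) j (hTB hj)
    · exact (hAB j (hTA hj) i (hTB hi)).symm
    · exact hclB i hi j hj hij
  have hα : 0 ≤ ∑ i ∈ TA, |x i| := Finset.sum_nonneg fun i _ => abs_nonneg _
  have hβ : 0 ≤ ∑ i ∈ TB, |x i| := Finset.sum_nonneg fun i _ => abs_nonneg _
  have hxA : restrictCoord A x ∈ (∑ i ∈ TA, |x i|) • stablePolytope G (A ∪ B) := by
    refine Set.smul_set_mono (stablePolytope_mono Finset.subset_union_left)
      (hA _ _ (restrictCoord_support x) fun T hT hcl => ?_)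
    rw [sum_abs_restrictCoord hT]
    exact hmaxA T hT hcl
  have hxB : restrictCoord B x ∈ (∑ i ∈ TB, |x i|) • stablePolytope G (A ∪ B) := by
    refine Set.smul_set_mono (stablePolytope_mono Finset.subset_union_right)
      (hB _ _ (restrictCoord_support x) fun T hT hcl => ?_)
    rw [sum_abs_restrictCoord hT]
    exact hmaxB T hT hcl
  have hr : r = (∑ i ∈ TA, |x i| + ∑ i ∈ TB, |x i|)
      + (r - (∑ i ∈ TA, |x i| + ∑ i ∈ TB, |x i|)) := by ring
  rw [hr, convex_stablePolytope.add_smul (add_nonneg hα hβ) (by linarith),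
    convex_stablePolytope.add_smul hα hβ]
  have h0 := Set.add_mem_add (Set.add_mem_add hxA hxB)
    (Set.smul_mem_smul_set (a := r - (∑ i ∈ TA, |x i| + ∑ i ∈ TB, |x i|))
      (zero_mem_stablePolytope (G := G) (S := A ∪ B)))
  rwa [smul_zero, add_zero, restrictCoord_add_restrictCoord hdisj hx] at h0

/-- For a graph without induced path on four vertices the stable set polytope is a Hanner polytope,
and it is given by the clique inequalities. Both follow along the decomposition of the graph into
disjoint unions and joins. -/
theorem isHanner_and_cliqueDetermined (hG : ∀ a b c d, ¬ IsInducedPath G a b c d)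
    (S : Finset (Fin n)) (hS : S.Nonempty) :
    IsHanner (stablePolytope G S) ∧ CliqueDetermined G S := by
  induction S using Finset.strongInduction with
  | H S ih =>
    rcases hS.exists_eq_singleton_or_nontrivial with ⟨i, rfl⟩ | hS'
    · refine ⟨?_, cliqueDetermined_singleton i⟩
      rw [stablePolytope_singleton]
      exact IsHanner.interval _ (by simp)
    have hss : ∀ {A B : Finset (Fin n)}, (∀ a ∈ A, a ∉ B) → A.Nonempty → B.Nonempty →
        A ⊂ A ∪ B ∧ B ⊂ A ∪ B := by
      intro A B hAB ⟨a, ha⟩ ⟨b, hb⟩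
      refine ⟨⟨Finset.subset_union_left, fun h => ?_⟩, ⟨Finset.subset_union_right, fun h => ?_⟩⟩
      · exact hAB b (h (Finset.mem_union_right _ hb)) hb
      · exact hAB a ha (h (Finset.mem_union_left _ ha))
    rcases splitsInto_or_compl hG S hS' with h | h
    · obtain ⟨A, B, hA, hB, rfl, hAB⟩ := h
      have hdisj : ∀ a ∈ A, a ∉ B := fun a ha hb => (hAB a ha a hb).ne rfl
      obtain ⟨hA1, hA2⟩ := ih A (hss hdisj hA hB).1 hA
      obtain ⟨hB1, hB2⟩ := ih B (hss hdisj hA hB).2 hB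
      refine ⟨?_, hA2.union hB2 hAB⟩
      rw [stablePolytope_union hAB]
      exact IsHanner.linftySum _ _ hA1 hB1 (disjoint_span_stablePolytope hdisj)
    · obtain ⟨A, B, hA, hB, rfl, hAB⟩ := h
      rw [compl_compl] at hAB
      have hdisj : ∀ a ∈ A, a ∉ B := fun a ha hb => (hAB a ha a hb).ne rfl
      obtain ⟨hA1, hA2⟩ := ih A (hss hdisj hA hB).1 hA
      obtain ⟨hB1, hB2⟩ := ih B (hss hdisj hA hB).2 hB
      refine ⟨?_, hA2.join hB2 hAB⟩
      rw [stablePolytope_join hAB]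
      exact IsHanner.l1Sum _ _ hA1 hB1 (disjoint_span_stablePolytope hdisj)

end HannerOfGraph

/-! ### Unconditional bodies and their corners -/

section Corner

variable {n : ℕ}

/-- The corner `{x ≥ 0 : (a₁ x₁, …, aₙ xₙ) ∈ M}` of `M`, in rescaled coordinates. -/
def scaledCorner (a : Fin n → ℝ) (M : Set (EuclideanSpace ℝ (Fin n))) : Set (Fin n → ℝ) :=
  {x | 0 ≤ x ∧ WithLp.toLp 2 (a * x) ∈ M}

theorem IsUnconditional.abs_mem {M : Set (EuclideanSpace ℝ (Fin n))} (hM : IsUnconditional M)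
    {x y : EuclideanSpace ℝ (Fin n)} (hx : x ∈ M) (h : ∀ i, |y i| = |x i|) : y ∈ M :=
  hM x hx y fun i => abs_eq_abs.1 (h i)

theorem IsUnconditional.polarBody {M : Set (EuclideanSpace ℝ (Fin n))} (hM : IsUnconditional M) :
    IsUnconditional (polarBody M) := by
  intro y hy y' h x hx
  have hx' : WithLp.toLp 2 (fun i => if y' i = y i then x i else -x i) ∈ M :=
    hM x hx _ fun i => by
      by_cases hi : y' i = y i <;> simp [hi]
  refine le_trans (le_of_eq ?_) (hy _ hx')
  simp only [PiLp.inner_apply]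
  refine Finset.sum_congr rfl fun i _ => ?_
  by_cases hi : y' i = y i
  · simp [hi]
  · have hne : -y i ≠ y i := by
      rwa [← (h i).resolve_left hi]
    simp [(h i).resolve_left hi, hne]

theorem isClosed_polarBody (M : Set (EuclideanSpace ℝ (Fin n))) : IsClosed (polarBody M) := by
  have : polarBody M = ⋂ x ∈ M, {y | inner ℝ x y ≤ 1} := by
    ext y
    simp [polarBody]
  rw [this]
  exact isClosed_biInter fun x _ => isClosed_le (by fun_prop) continuous_const

/-- The `2ⁿ` reflected copies of the open corner of an unconditional body are disjoint. -/
theorem two_pow_mul_cornerVol_le {M : Set (EuclideanSpace ℝ (Fin n))} (hM : IsUnconditional M)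
    (hfin : volume M ≠ ⊤) (hmeas : MeasurableSet M) {a : Fin n → ℝ} (ha : ∀ i, 0 < a i) :
    2 ^ n * ((∏ i, a i) * cornerVol (scaledCorner a M)) ≤ volume.real M := by
  obtain ⟨M', hM'⟩ : ∃ M' : Set (Fin n → ℝ), M' = WithLp.toLp 2 ⁻¹' M := ⟨_, rfl⟩
  have hvol : volume M' = volume M := by
    rw [hM']
    exact (PiLp.volume_preserving_toLp (Fin n)).measure_preimage hmeas.nullMeasurableSet
  obtain ⟨Q, hQ⟩ : ∃ Q, Q = scaledCorner a M ∩ openOrthant n := ⟨_, rfl⟩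
  have hQm : MeasurableSet Q := by
    rw [hQ]
    refine MeasurableSet.inter (MeasurableSet.inter ?_ ?_) (measurableSet_openOrthant n)
    · exact (isClosed_le continuous_const continuous_id).measurableSet
    · refine measurableSet_preimage ?_ hmeas
      exact (PiLp.volume_preserving_toLp (Fin n)).measurable.comp
        (measurable_const.mul measurable_id)
  let s : (Fin n → Bool) → Fin n → ℝ := fun σ i => if σ i then a i else -a i
  have hs : ∀ σ i, |s σ i| = a i := fun σ i => by
    by_cases h : σ i <;> simp [s, h, abs_of_pos (ha i)]
  let P : (Fin n → Bool) → Set (Fin n → ℝ) := fun σ =>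
    (Matrix.toLin' (Matrix.diagonal (s σ))) '' Q
  have hdet : ∀ σ, |LinearMap.det (Matrix.toLin' (Matrix.diagonal (s σ)))| = ∏ i, a i := by
    intro σ
    rw [LinearMap.det_toLin', Matrix.det_diagonal, Finset.abs_prod]
    simp_rw [hs]
  have happ : ∀ σ (x : Fin n → ℝ), Matrix.toLin' (Matrix.diagonal (s σ)) x = s σ * x := by
    intro σ x
    ext i
    simp [Matrix.mulVec_diagonal]
  have hprod : 0 < ∏ i, a i := Finset.prod_pos fun i _ => ha i
  have hPvol : ∀ σ, volume (P σ) = ENNReal.ofReal (∏ i, a i) * volume Q := by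
    intro σ
    rw [Measure.addHaar_image_linearMap, hdet]
  have hPsub : ∀ σ, P σ ⊆ M' := by
    rintro σ _ ⟨x, hx, rfl⟩
    rw [hQ] at hx
    rw [hM', Set.mem_preimage, happ]
    refine hM.abs_mem hx.1.2 fun i => ?_
    simp [abs_mul, hs, abs_of_pos (ha i)]
  have hPmeas : ∀ σ, MeasurableSet (P σ) := by
    intro σ
    have hinj : Function.Injective (Matrix.toLin' (Matrix.diagonal (s σ))) := by
      intro x y hxy
      rw [happ, happ] at hxy
      ext i
      have hne : s σ i ≠ 0 := by
        rw [← abs_pos, hs]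
        exact ha i
      exact mul_left_cancel₀ hne (congrFun hxy i)
    exact (LinearMap.continuous_on_pi _).measurable.measurableEmbedding hinj |>.measurableSet_image.2 hQm
  have hPdisj : Pairwise fun σ τ => Disjoint (P σ) (P τ) := by
    intro σ τ hστ
    refine Set.disjoint_left.2 ?_
    rintro _ ⟨x, hx, rfl⟩ ⟨y, hy, hxy⟩
    rw [hQ] at hx hy
    apply hστ
    ext i
    have h1 := congrFun hxy i
    rw [happ, happ, Pi.mul_apply, Pi.mul_apply] at h1
    have hxi := mul_pos (ha i) (hx.2 i)
    have hyi := mul_pos (ha i) (hy.2 i)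
    cases hσ : σ i <;> cases hτ : τ i <;> simp only [s, hσ, hτ] at h1 <;> simp at h1 ⊢ <;> linarith
  have hPfin : ∀ σ, volume (P σ) ≠ ⊤ := fun σ =>
    measure_ne_top_of_subset (hPsub σ) (hvol ▸ hfin)
  have hreal : ∀ σ, volume.real (P σ) = (∏ i, a i) * cornerVol (scaledCorner a M) := by
    intro σ
    rw [Measure.real, hPvol, ENNReal.toReal_mul, ENNReal.toReal_ofReal hprod.le, hQ]
    rfl
  have h1 := measureReal_biUnion_finset (μ := volume) (s := Finset.univ) (f := P)
    (fun σ _ τ _ h => hPdisj h) (fun σ _ => hPmeas σ) (fun σ _ => hPfin σ)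
  simp only [hreal, Finset.mem_univ, Set.iUnion_true, Finset.sum_const, Finset.card_univ,
    Fintype.card_fun, Fintype.card_bool, Fintype.card_fin, nsmul_eq_mul, Nat.cast_pow,
    Nat.cast_ofNat] at h1
  rw [← h1, Measure.real, Measure.real, ← hvol]
  exact ENNReal.toReal_mono (hvol ▸ hfin) (measure_mono (Set.iUnion_subset hPsub))

theorem inner_toLp (x y : Fin n → ℝ) :
    inner ℝ (WithLp.toLp 2 x) (WithLp.toLp 2 y) = x ⬝ᵥ y := by
  simp [PiLp.inner_apply, dotProduct, mul_comm]

theorem mul_dotProduct_inv_mul {a : Fin n → ℝ} (ha : ∀ i, 0 < a i) (x y : Fin n → ℝ) :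
    (a * x) ⬝ᵥ (a⁻¹ * y) = x ⬝ᵥ y := by
  refine Finset.sum_congr rfl fun i _ => ?_
  have := (ha i).ne'
  simp only [Pi.mul_apply, Pi.inv_apply]
  field_simp

/-- The bipolar theorem for corners of unconditional bodies. The scaling factors `a i` are the
maxima of the coordinates on `K`. -/
theorem isPolarPair_scaledCorner {K : Set (EuclideanSpace ℝ (Fin n))} (hconv : Convex ℝ K)
    (hclosed : IsClosed K) (hK : IsUnconditional K) {a : Fin n → ℝ} (ha : ∀ i, 0 < a i)
    (hmax : ∀ i, ∀ x ∈ K, x i ≤ a i) (hatt : ∀ i, ∃ x ∈ K, x i = a i) (hne : K.Nonempty) :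
    IsPolarPair (scaledCorner a K) (scaledCorner a⁻¹ (polarBody K)) := by
  have hle : ∀ x ∈ scaledCorner a K, ∀ y ∈ scaledCorner a⁻¹ (polarBody K), x ⬝ᵥ y ≤ 1 := by
    intro x hx y hy
    have := hy.2 _ hx.2
    rwa [inner_toLp, mul_dotProduct_inv_mul ha] at this
  have ha' : ∀ i, a i ≠ 0 := fun i => (ha i).ne'
  refine ⟨fun x => ⟨fun hx => ⟨hx.1, hle x hx⟩, fun hx => ⟨hx.1, ?_⟩⟩,
    fun y => ⟨fun hy => ⟨hy.1, fun x hx => hle x hx y hy⟩, fun hy => ⟨hy.1, ?_⟩⟩,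
    fun i => ?_, fun i => ?_⟩
  · by_contra hxK
    obtain ⟨g, u, hgu, hug⟩ := geometric_hahn_banach_closed_point hconv hclosed hxK
    obtain ⟨v, rfl⟩ := (InnerProductSpace.toDual ℝ (EuclideanSpace ℝ (Fin n))).surjective g
    simp only [InnerProductSpace.toDual_apply_apply] at hgu hug
    have h0K : (0 : EuclideanSpace ℝ (Fin n)) ∈ K := by
      obtain ⟨z, hz⟩ := hne
      have hz' : -z ∈ K := hK.abs_mem hz fun i => by simp
      have := hconv hz hz' (by norm_num : (0 : ℝ) ≤ 1 / 2) (by norm_num : (0 : ℝ) ≤ 1 / 2)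
        (by norm_num)
      simpa using this
    have hu : 0 < u := by simpa using hgu 0 h0K
    -- by unconditionality the separating functional may be taken non-negative
    have habs : ∀ z ∈ K, ∑ i, z i * |v i| ≤ u := by
      intro z hz
      have hz' : WithLp.toLp 2 (fun i => if 0 ≤ v i then z i else -z i) ∈ K :=
        hK z hz _ fun i => by
          by_cases hi : 0 ≤ v i <;> simp [hi]
      refine le_trans (le_of_eq ?_) (hgu _ hz').le
      simp only [PiLp.inner_apply]
      refine Finset.sum_congr rfl fun i _ => ?_
      by_cases hi : 0 ≤ v i
      · simp [hi, abs_of_nonneg hi]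
      · simp [hi, abs_of_neg (not_le.1 hi)]
    have hy : (fun i => a i * |v i| / u) ∈ scaledCorner a⁻¹ (polarBody K) := by
      refine ⟨fun i => by have := ha i; dsimp; positivity, fun z hz => ?_⟩
      have : inner ℝ z (WithLp.toLp 2 (a⁻¹ * fun i => a i * |v i| / u))
          = (∑ i, z i * |v i|) / u := by
        rw [PiLp.inner_apply, Finset.sum_div]
        refine Finset.sum_congr rfl fun i _ => ?_
        have := ha' i
        simp
        field_simp
      rw [this, div_le_one hu]
      exact habs z hz
    have h1 := hx.2 _ hy
    have h2 : x ⬝ᵥ (fun i => a i * |v i| / u) = (∑ i, a i * x i * |v i|) / u := by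
      rw [dotProduct, Finset.sum_div]
      exact Finset.sum_congr rfl fun i _ => by ring
    rw [h2, div_le_one hu] at h1
    have h3 : inner ℝ v (WithLp.toLp 2 (a * x)) ≤ ∑ i, a i * x i * |v i| := by
      rw [PiLp.inner_apply]
      refine Finset.sum_le_sum fun i _ => ?_
      simp only [Pi.mul_apply, RCLike.inner_apply, conj_trivial]
      exact mul_le_mul_of_nonneg_left (le_abs_self _) (mul_nonneg (ha i).le (hx.1 i))
    linarith
  · intro z hz
    have hx : (fun i => |z i| / a i) ∈ scaledCorner a K := by
      refine ⟨fun i => div_nonneg (abs_nonneg _) (ha i).le, hK.abs_mem hz fun i => ?_⟩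
      have := ha' i
      simp only [Pi.mul_apply]
      rw [mul_div_cancel₀ _ this, abs_abs]
    refine le_trans ?_ (hy.2 _ hx)
    rw [PiLp.inner_apply, dotProduct]
    refine Finset.sum_le_sum fun i _ => ?_
    simp only [Pi.mul_apply, Pi.inv_apply, RCLike.inner_apply, conj_trivial]
    have h1 : 0 ≤ (a i)⁻¹ * y i := mul_nonneg (inv_nonneg.2 (ha i).le) (hy.1 i)
    calc (a i)⁻¹ * y i * z i ≤ (a i)⁻¹ * y i * |z i| :=
          mul_le_mul_of_nonneg_left (le_abs_self _) h1
      _ = |z i| / a i * y i := by ring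
  · refine ⟨Pi.single_nonneg.2 zero_le_one, ?_⟩
    obtain ⟨x, hx, hxi⟩ := hatt i
    have hx' : WithLp.toLp 2 (fun j => if j = i then x j else -x j) ∈ K :=
      hK x hx _ fun j => by
        by_cases hj : j = i <;> simp [hj]
    have := hconv hx hx' (by norm_num : (0 : ℝ) ≤ 1 / 2) (by norm_num : (0 : ℝ) ≤ 1 / 2)
      (by norm_num)
    convert this using 1
    ext j
    by_cases hj : j = i
    · subst hj
      simp [hxi]
      ring
    · simp [hj]
  · refine ⟨Pi.single_nonneg.2 zero_le_one, fun z hz => ?_⟩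
    have : inner ℝ z (WithLp.toLp 2 (a⁻¹ * Pi.single i 1)) = z i / a i := by
      rw [PiLp.inner_apply, Finset.sum_eq_single i]
      · simp
        ring
      · intro j _ hj
        simp [hj]
      · simp
    rw [this, div_le_one (ha i)]
    exact hmax i z hz

end Corner

/-! ### The cube -/

theorem volume_crossPolytope (n : ℕ) [NeZero n] :
    volume {x : Fin n → ℝ | ∑ i, |x i| ≤ 1} = ENNReal.ofReal (2 ^ n / n.factorial) := by
  have h := volume_sum_rpow_le (Fin n) le_rfl 1
  simp only [Real.rpow_one, div_one, ENNReal.ofReal_one, one_pow, one_mul, Fintype.card_fin] at h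
  rw [h, Real.Gamma_nat_eq_factorial, one_add_one_eq_two, Real.Gamma_two, mul_one]

theorem volumeProduct_unitCube_le (n : ℕ) [NeZero n] :
    volumeProduct (unitCube n) ≤ 4 ^ n / n.factorial := by
  have h1 : volume.real (unitCube n) = 2 ^ n := by
    have h : volume (unitCube n) = volume (Set.Icc (-1 : Fin n → ℝ) 1) := by
      rw [← (PiLp.volume_preserving_ofLp (Fin n)).measure_preimage
        measurableSet_Icc.nullMeasurableSet]
      congr 1
      ext x
      simp only [unitCube, Set.mem_ofPred_eq, Set.mem_preimage, Set.mem_Icc, Pi.le_def, abs_le,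
        forall_and]
      rfl
    rw [Measure.real, h, Real.volume_Icc_pi]
    norm_num
  have h2 : volume.real (polarBody (unitCube n)) ≤ 2 ^ n / n.factorial := by
    have hclosed : IsClosed {x : Fin n → ℝ | ∑ i, |x i| ≤ 1} :=
      isClosed_le (by fun_prop) continuous_const
    have h : volume (polarBody (unitCube n)) ≤ volume {x : Fin n → ℝ | ∑ i, |x i| ≤ 1} := by
      rw [← (PiLp.volume_preserving_ofLp (Fin n)).measure_preimage
        hclosed.measurableSet.nullMeasurableSet]
      refine measure_mono fun y hy => ?_
      have := hy (WithLp.toLp 2 fun i => if 0 ≤ y i then 1 else -1) fun i => by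
        by_cases hi : 0 ≤ y i <;> simp [hi]
      rw [PiLp.inner_apply] at this
      refine le_trans (le_of_eq ?_) this
      refine Finset.sum_congr rfl fun i _ => ?_
      by_cases hi : 0 ≤ y i
      · simp [hi, abs_of_nonneg hi]
      · simp [hi, abs_of_neg (not_le.1 hi)]
    rw [volume_crossPolytope] at h
    exact ENNReal.toReal_le_of_le_ofReal (by positivity) h
  calc volumeProduct (unitCube n) ≤ 2 ^ n * (2 ^ n / n.factorial) := by
        rw [volumeProduct, h1]
        gcongr
    _ = 4 ^ n / n.factorial := by
        rw [← mul_div_assoc, ← mul_pow]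
        norm_num

/-! ### From corners back to bodies -/

/-- The diagonal linear automorphism with the given non-zero entries. -/
noncomputable def diagEquiv {n : ℕ} (c : Fin n → ℝ) (hc : ∀ i, c i ≠ 0) :
    EuclideanSpace ℝ (Fin n) ≃ₗ[ℝ] EuclideanSpace ℝ (Fin n) where
  toFun x := WithLp.toLp 2 fun i => c i * x i
  invFun x := WithLp.toLp 2 fun i => (c i)⁻¹ * x i
  map_add' x y := by
    ext i
    simp [mul_add]
  map_smul' r x := by
    ext i
    simp
    ring
  left_inv x := by
    ext i
    simp [hc i]
  right_inv x := by
    ext i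
    simp [hc i]

theorem banachMazurDist_le {n : ℕ} {K L : Set (EuclideanSpace ℝ (Fin n))} {d : ℝ} (hd : 1 ≤ d)
    (T : EuclideanSpace ℝ (Fin n) ≃ₗ[ℝ] EuclideanSpace ℝ (Fin n)) (h1 : L ⊆ T '' K)
    (h2 : T '' K ⊆ d • L) : banachMazurDist K L ≤ d :=
  csInf_le ⟨1, fun _ h => h.1⟩ ⟨hd, T, h1, h2⟩

theorem interior_nonempty_of_subset_smul {n : ℕ} {K L : Set (EuclideanSpace ℝ (Fin n))} {d : ℝ}
    (hd : d ≠ 0) (T : EuclideanSpace ℝ (Fin n) ≃ₗ[ℝ] EuclideanSpace ℝ (Fin n))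
    (hK : (interior K).Nonempty) (h : T '' K ⊆ d • L) : (interior L).Nonempty := by
  have h1 : (interior (T '' K)).Nonempty := by
    have := T.toContinuousLinearEquiv.toHomeomorph.image_interior K
    have h2 : (T.toContinuousLinearEquiv.toHomeomorph '' interior K).Nonempty := hK.image _
    rw [this] at h2
    exact h2
  have h2 := h1.mono (interior_mono h)
  rw [interior_smul₀ hd] at h2
  exact Set.smul_set_nonempty.1 h2

section Body

variable {n : ℕ} {K : Set (EuclideanSpace ℝ (Fin n))}

/-- The maxima of the coordinates on an unconditional convex body are positive and attained. -/
theorem exists_coord_max (hK : IsConvexBody K) (hu : IsUnconditional K) :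
    ∃ a : Fin n → ℝ, (∀ i, 0 < a i) ∧ (∀ i, ∀ x ∈ K, x i ≤ a i) ∧ ∀ i, ∃ x ∈ K, x i = a i := by
  obtain ⟨-, hcomp, p, hp⟩ := hK
  have hmax : ∀ i : Fin n, ∃ x ∈ K, ∀ y ∈ K, y i ≤ x i := fun i =>
    hcomp.exists_isMaxOn ⟨p, interior_subset hp⟩
      (f := fun x : EuclideanSpace ℝ (Fin n) => x i) (by fun_prop)
  choose x hxK hx using hmax
  refine ⟨fun i => x i i, fun i => ?_, fun i y hy => hx i y hy, fun i => ⟨x i, hxK i, rfl⟩⟩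
  have hex : ∃ z ∈ K, z i ≠ 0 := by
    by_contra! hc
    obtain ⟨r, hr, hball⟩ := Metric.mem_nhds_iff.1 (mem_interior_iff_mem_nhds.1 hp)
    have hmem : p + EuclideanSpace.single i (r / 2) ∈ K := by
      apply hball
      rw [Metric.mem_ball, dist_eq_norm, add_sub_cancel_left, PiLp.norm_single,
        Real.norm_of_nonneg (by linarith)]
      linarith
    have h1 := hc _ hmem
    have h2 := hc _ (interior_subset hp)
    simp [h2] at h1
    linarith
  obtain ⟨z, hz, hzi⟩ := hex
  have hz' : WithLp.toLp 2 (fun j => |z j|) ∈ K := hu.abs_mem hz fun j => by simp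
  exact (abs_pos.2 hzi).trans_le (hx i _ hz')

theorem volume_polarBody_ne_top (hu : IsUnconditional K) {a : Fin n → ℝ} (ha : ∀ i, 0 < a i)
    (hsingle : ∀ i, Pi.single i 1 ∈ scaledCorner a K) : volume (polarBody K) ≠ ⊤ := by
  have hsub : polarBody K ⊆ WithLp.ofLp ⁻¹' Set.Icc (-a⁻¹) a⁻¹ := by
    intro y hy
    have h1 : ∀ i, ∀ s : ℝ, |s| = 1 → s * y i ≤ (a i)⁻¹ := by
      intro i s hs
      have hmem : EuclideanSpace.single i (s * a i) ∈ K := by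
        refine hu.abs_mem (hsingle i).2 fun j => ?_
        by_cases hj : j = i
        · subst hj
          simp [abs_mul, hs]
        · simp [hj]
      have h2 := hy _ hmem
      rw [EuclideanSpace.inner_single_left] at h2
      simp only [conj_trivial] at h2
      rw [← one_div, le_div_iff₀ (ha i)]
      linarith
    refine ⟨fun i => ?_, fun i => ?_⟩
    · have := h1 i (-1) (by simp)
      simp only [Pi.neg_apply, Pi.inv_apply]
      linarith
    · simpa using h1 i 1 (by simp)
  refine measure_ne_top_of_subset hsub ?_
  rw [(PiLp.volume_preserving_ofLp (Fin n)).measure_preimage measurableSet_Icc.nullMeasurableSet]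
  exact isCompact_Icc.measure_lt_top.ne

/-- A body whose corner almost contains the independent sets of `G`, and whose polar almost
contains the cliques, is close to the polytope of `G`. -/
theorem sandwich (hconv : Convex ℝ K) (hu : IsUnconditional K) {G : SimpleGraph (Fin n)}
    {a : Fin n → ℝ} (ha : ∀ i, 0 < a i) {lam : ℝ} (hlam : 0 < lam)
    (hG : CliqueDetermined G Finset.univ)
    (hpair : IsPolarPair (scaledCorner a K) (scaledCorner a⁻¹ (polarBody K)))
    (hI : ∀ I : Finset (Fin n), (∀ i ∈ I, ∀ j ∈ I, ¬ G.Adj i j) →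
      (fun i => if i ∈ I then lam else 0) ∈ scaledCorner a K)
    (hT : ∀ T : Finset (Fin n), (∀ i ∈ T, ∀ j ∈ T, i ≠ j → G.Adj i j) →
      (fun i => if i ∈ T then lam else 0) ∈ scaledCorner a⁻¹ (polarBody K)) :
    ∃ T : EuclideanSpace ℝ (Fin n) ≃ₗ[ℝ] EuclideanSpace ℝ (Fin n),
      stablePolytope G Finset.univ ⊆ T '' K ∧
        T '' K ⊆ (lam⁻¹ * lam⁻¹) • stablePolytope G Finset.univ := by
  have hc : ∀ i, (lam * a i)⁻¹ ≠ 0 := fun i => inv_ne_zero (mul_pos hlam (ha i)).ne'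
  refine ⟨diagEquiv (fun i => (lam * a i)⁻¹) hc, ?_, ?_⟩
  · refine convexHull_min (fun x hx => ?_)
      (hconv.linear_image (diagEquiv (fun i => (lam * a i)⁻¹) hc).toLinearMap)
    classical
    have h1 := hI (Finset.univ.filter fun i => x i ≠ 0) fun i hi j hj =>
      hx.2.2 i j (by simpa using hi) (by simpa using hj)
    refine ⟨(diagEquiv (fun i => (lam * a i)⁻¹) hc).symm x, ?_, LinearEquiv.apply_symm_apply _ _⟩
    refine hu.abs_mem h1.2 fun i => ?_
    change |((lam * a i)⁻¹)⁻¹ * x i| = |a i * _|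
    rcases hx.1 i with h | h | h <;> simp [h, abs_mul, mul_comm]
  · rintro _ ⟨k, hk, rfl⟩
    refine hG _ _ (fun i _ => Finset.mem_univ i) fun T _ hcl => ?_
    have hw : (fun i => |k i| / a i) ∈ scaledCorner a K := by
      refine ⟨fun i => div_nonneg (abs_nonneg _) (ha i).le, hu.abs_mem hk fun i => ?_⟩
      simp only [Pi.mul_apply]
      rw [mul_div_cancel₀ _ (ha i).ne', abs_abs]
    have h1 := hpair.dot_le hw (hT T hcl)
    simp only [dotProduct, mul_ite, mul_zero, Finset.sum_ite_mem, Finset.univ_inter] at h1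
    rw [← Finset.sum_mul] at h1
    have h2 : ∑ i ∈ T, |diagEquiv (fun i => (lam * a i)⁻¹) hc k i|
        = lam⁻¹ * ∑ i ∈ T, |k i| / a i := by
      rw [Finset.mul_sum]
      refine Finset.sum_congr rfl fun i _ => ?_
      change |(lam * a i)⁻¹ * k i| = _
      rw [abs_mul, abs_inv, abs_of_pos (mul_pos hlam (ha i)), mul_inv]
      ring
    rw [h2]
    refine mul_le_mul_of_nonneg_left ?_ (inv_nonneg.2 hlam.le)
    rw [← one_div, le_div_iff₀ hlam]
    exact h1

theorem factorial_mul_cornerVol_le [NeZero n] (hK : IsConvexBody K) (hu : IsUnconditional K)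
    {a : Fin n → ℝ} (ha : ∀ i, 0 < a i)
    (hpair : IsPolarPair (scaledCorner a K) (scaledCorner a⁻¹ (polarBody K))) {ε : ℝ}
    (hε : volumeProduct K ≤ volumeProduct (unitCube n) + ε) :
    n.factorial * (cornerVol (scaledCorner a K) * cornerVol (scaledCorner a⁻¹ (polarBody K)))
      ≤ 1 + n.factorial / 4 ^ n * ε := by
  have h1 := two_pow_mul_cornerVol_le hu hK.2.1.measure_lt_top.ne hK.2.1.measurableSet ha
  have h2 := two_pow_mul_cornerVol_le hu.polarBody (volume_polarBody_ne_top hu ha hpair.single_left)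
    (isClosed_polarBody K).measurableSet (a := a⁻¹) fun i => inv_pos.2 (ha i)
  have hprod : (∏ i, a i) * ∏ i, a⁻¹ i = 1 := by
    rw [← Finset.prod_mul_distrib]
    exact Finset.prod_eq_one fun i _ => mul_inv_cancel₀ (ha i).ne'
  have hv := IsPolarPair.cornerVol_nonneg (scaledCorner a⁻¹ (polarBody K))
  have hpos : 0 ≤ ∏ i, a⁻¹ i := Finset.prod_nonneg fun i _ => (inv_pos.2 (ha i)).le
  have h3 := mul_le_mul h1 h2 (by positivity) measureReal_nonneg
  have h4 : 2 ^ n * ((∏ i, a i) * cornerVol (scaledCorner a K))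
      * (2 ^ n * ((∏ i, a⁻¹ i) * cornerVol (scaledCorner a⁻¹ (polarBody K))))
      = 4 ^ n * (cornerVol (scaledCorner a K) * cornerVol (scaledCorner a⁻¹ (polarBody K))) := by
    have h5 : (4 : ℝ) ^ n = 2 ^ n * 2 ^ n := by
      rw [← mul_pow]
      norm_num
    rw [h5]
    linear_combination (2 ^ n * 2 ^ n * (cornerVol (scaledCorner a K) *
      cornerVol (scaledCorner a⁻¹ (polarBody K)))) * hprod
  rw [h4] at h3
  have h6 := h3.trans (hε.trans (add_le_add_left (volumeProduct_unitCube_le n) ε))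
  have hf : (0 : ℝ) < n.factorial := by exact_mod_cast n.factorial_pos
  have h7 := mul_le_mul_of_nonneg_left h6 (by positivity : (0 : ℝ) ≤ n.factorial / 4 ^ n)
  calc _ = n.factorial / 4 ^ n * (4 ^ n * (cornerVol (scaledCorner a K) *
        cornerVol (scaledCorner a⁻¹ (polarBody K)))) := by field_simp
    _ ≤ _ := h7
    _ = _ := by field_simp

end Body

theorem theorem1 (n : ℕ) (hn : 1 ≤ n) :
    ∃ ε₀ : ℝ, 0 < ε₀ ∧ ∃ c : ℝ, 0 < c ∧
      ∀ ε : ℝ, 0 < ε → ε ≤ ε₀ →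
        ∀ K : Set (EuclideanSpace ℝ (Fin n)), IsConvexBody K → IsUnconditional K →
          |volumeProduct K - volumeProduct (unitCube n)| ≤ ε →
            ∃ H : Set (EuclideanSpace ℝ (Fin n)), IsHannerPolytope H ∧
              banachMazurDist K H ≤ 1 + c * ε := by
  have : NeZero n := ⟨by omega⟩
  obtain ⟨C, δ₀, hC, hδ₀, hCδ, hgraph⟩ := IsPolarPair.exists_graph n
  have hf : (0 : ℝ) < n.factorial := by exact_mod_cast n.factorial_pos
  obtain ⟨q, hq⟩ : ∃ q : ℝ, q = n.factorial / 4 ^ n := ⟨_, rfl⟩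
  have hq0 : 0 < q := by rw [hq]; positivity
  refine ⟨δ₀ / q, by positivity, 6 * (C * q), by positivity, fun ε hε0 hε K hK hu hP => ?_⟩
  obtain ⟨a, ha, hmax, hatt⟩ := exists_coord_max hK hu
  have hpair := isPolarPair_scaledCorner hK.1 hK.2.1.isClosed hu ha hmax hatt
    (hK.2.2.mono interior_subset)
  have hvol := factorial_mul_cornerVol_le hK hu ha hpair (ε := ε)
    (by linarith [(abs_le.1 hP).2])
  rw [← hq] at hvol
  rw [le_div_iff₀ hq0, mul_comm] at hε
  obtain ⟨G, hG, hI, hT⟩ := hgraph _ _ (q * ε) hpair (by positivity) hε hvol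
  obtain ⟨g, hg⟩ : ∃ g, g = C * (q * ε) := ⟨_, rfl⟩
  rw [← hg] at hI hT
  have hg0 : 0 ≤ g := by rw [hg]; positivity
  have hg1 : g ≤ 1 / 4 := by
    rw [hg]
    exact (mul_le_mul_of_nonneg_left hε hC.le).trans hCδ
  obtain ⟨hH, hcl⟩ := isHanner_and_cliqueDetermined hG Finset.univ Finset.univ_nonempty
  obtain ⟨T, h1, h2⟩ := sandwich hK.1 hu ha (by linarith : 0 < 1 - g) hcl hpair hI hT
  have hlam : 0 < 1 - g := by linarith
  have hinv : 1 ≤ (1 - g)⁻¹ := (one_le_inv₀ hlam).2 (by linarith)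
  refine ⟨stablePolytope G Finset.univ,
    ⟨hH, interior_nonempty_of_subset_smul (by positivity) T hK.2.2 h2⟩, ?_⟩
  refine (banachMazurDist_le (one_le_mul_of_one_le_of_one_le hinv hinv) T h1 h2).trans ?_
  have h3 : 1 + 6 * (C * q) * ε = 1 + 6 * g := by rw [hg]; ring
  rw [h3, ← mul_inv, inv_le_iff_one_le_mul₀ (by positivity)]
  nlinarith [mul_nonneg hg0 (mul_nonneg hg0 hg0)]
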